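/- Let $\alpha\in(0,1)$ and $q:=\frac{2(2-\alpha)}{1-\alpha}$. For $n\ge 1$, $p\in(0,1]$ and a real random variable $\xi$, let $A_n$ denote an $n\times n$ random matrix with entries $a_{ij}=\delta_{ij}\xi_{ij}$, where the $\delta_{ij}$ are Bernoulli random variables with $\mathbb P(\delta_{ij}=1)=p$, the $\xi_{ij}$ are copies of $\xi$, and all the $\delta_{ij},\xi_{ij}$ are mutually independent; $\|\cdot\|$ is the spectral norm. Let $(p_n)_{n\ge1}$ denote sequences in $(0,1]$, and let $A_n$ be formed with $p=p_n$. (i) Let $0<r<q$, $\bar K<\infty$, $M<\infty$, and suppose that $p_n=\Omega(n^{-\alpha})$, i.e. $\liminf_{n\to\infty} p_n/n^{-\alpha}\ge\kappa$ for some $\kappa>0$. Then there is a constant $\bar C>0$ such that for every centered $\xi$ with unit variance, $\mathbb E|\xi|^4\le M$ and $\mathbb E|\xi|^q<\bar K^q$, $$\mathbb E\|A_n\|^r\le \bar C\,(\sqrt{np_n})^r .$$ Here $\bar C$ can be chosen to depend only on $\alpha,\kappa,\bar K,r,M$, the bound then holding for all $n\ge n_0$ with $n_0$ not depending on $\xi$;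 and if $\bar C$ may depend on the whole sequence $(p_n)$ in place of $\kappa$, the bound holds for all $n\ge1$. (ii) There is an absolute constant $\bar C>0$ with the following property. For every $\alpha\in(0,1)$ and every $0<r<q$ there exist $\mu,\nu>0$, depending only on $r$ and $q$, such that for every $\bar K>0$ there is a centered random variable $\xi$ with $\mathbb E|\xi|^4<\infty$, $\mathbb E|\xi|^r<\bar K$ and $\mathbb E|\xi|^q=\infty$, which moreover has unit variance if $\bar K>1$, such that for every sequence with $p_n\sim n^{-\alpha}$ (i.e. $c\,n^{-\alpha}\le p_n\le C\,n^{-\alpha}$ for all large $n$, for some constants $c,C>0$), $$\mathbb P\big(\|A_n\|\le n^{\nu}\sqrt{np_n}\big)\le\exp(-\bar C n^{\mu})\qquad\text{for all sufficiently large } n.$$ -/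

import Mathlib

open MeasureTheory ProbabilityTheory Filter
open scoped ENNReal NNReal

universe u

noncomputable section

namespace SparseNorm

/-- `a_n = Ω(b_n)` with constant `κ`: `liminf a_n / b_n ≥ κ` (the liminf is taken in `[-∞, ∞]`). -/
def OmegaWith (κ : ℝ) (a b : ℕ → ℝ) : Prop :=
  (κ : EReal) ≤ liminf (fun n => ((a n / b n : ℝ) : EReal)) atTop

/-- `a_n = Ω(b_n)`: `liminf a_n / b_n ≥ κ` for some `κ > 0`. -/
def IsOmega (a b : ℕ → ℝ) : Prop :=
  ∃ κ : ℝ, 0 < κ ∧ OmegaWith κ a b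

/-- `a_n ∼ b_n`: `c b_n ≤ a_n ≤ C b_n` for all large `n`, for some constants `c, C > 0`. -/
def SameOrder (a b : ℕ → ℝ) : Prop :=
  ∃ c C : ℝ, 0 < c ∧ 0 < C ∧ ∀ᶠ n in atTop, c * b n ≤ a n ∧ a n ≤ C * b n

/-- The critical exponent `q = 2 (2 - α) / (1 - α)`. -/
def critExp (α : ℝ) : ℝ := 2 * (2 - α) / (1 - α)

/-- The absolute moment `E |ξ|^s ∈ [0, ∞]` of a real random variable `ξ` with law `ρ`. -/
def absMoment (ρ : Measure ℝ) (s : ℝ) : ℝ≥0∞ := ∫⁻ x, ‖x‖ₑ ^ s ∂ρ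

/-- A real random variable with law `ρ` is integrable and has mean zero. -/
def IsCentered (ρ : Measure ℝ) : Prop :=
  Integrable (fun x : ℝ => x) ρ ∧ ∫ x, x ∂ρ = 0

/-- The Bernoulli law with parameter `p`, as a measure on `ℝ` carried by `{0, 1}`. -/
def berLaw (p : ℝ) : Measure ℝ :=
  ENNReal.ofReal p • Measure.dirac 1 + ENNReal.ofReal (1 - p) • Measure.dirac 0

/-- The ingredients of an `n × n` sparse random matrix: the `δ i j` are Bernoulli with parameter
`p`, the `ξ i j` have law `ρ`, and all these `2 n²` random variables are mutually independent. -/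
structure IsSparseModel {Ω : Type*} [MeasurableSpace Ω] (P : Measure Ω) (n : ℕ) (p : ℝ)
    (ρ : Measure ℝ) (δ ξ : Fin n → Fin n → Ω → ℝ) : Prop where
  measurable_delta : ∀ i j, Measurable (δ i j)
  measurable_xi : ∀ i j, Measurable (ξ i j)
  law_delta : ∀ i j, P.map (δ i j) = berLaw p
  law_xi : ∀ i j, P.map (ξ i j) = ρ
  indep : iIndepFun
    (Sum.elim (fun ij : Fin n × Fin n => δ ij.1 ij.2) (fun ij : Fin n × Fin n => ξ ij.1 ij.2)) P

/-- The random matrix with entries `a_{ij} = δ_{ij} ξ_{ij}`. -/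
def sparseMatrix {Ω : Type*} {n : ℕ} (δ ξ : Fin n → Fin n → Ω → ℝ) (ω : Ω) :
    Matrix (Fin n) (Fin n) ℝ :=
  Matrix.of fun i j => δ i j ω * ξ i j ω

/-- The spectral norm: the operator norm on Euclidean space. -/
def specNorm {n : ℕ} (A : Matrix (Fin n) (Fin n) ℝ) : ℝ :=
  ‖Matrix.toEuclideanCLM (n := Fin n) (𝕜 := ℝ) A‖

/-- The bound `E ‖A_n‖^r ≤ C (√(n p))^r` for every `n × n` sparse random matrix with parameter `p`
whose entries `ξ_{ij}` are copies of a centered `ξ` of unit variance with `E |ξ|^4 ≤ M` and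
`E |ξ|^q < K^q`. -/
def NormMomentBound (q : ℝ) (K M : ℝ≥0) (r C : ℝ) (n : ℕ) (p : ℝ) : Prop :=
  ∀ ρ : Measure ℝ, IsProbabilityMeasure ρ → IsCentered ρ → Var[fun x : ℝ => x; ρ] = 1 →
    absMoment ρ 4 ≤ M → absMoment ρ q < (K : ℝ≥0∞) ^ q →
    ∀ (Ω : Type u) [MeasurableSpace Ω] (P : Measure Ω) [IsProbabilityMeasure P]
      (δ ξ : Fin n → Fin n → Ω → ℝ), IsSparseModel P n p ρ δ ξ →
      ∫⁻ ω, ENNReal.ofReal (specNorm (sparseMatrix δ ξ ω)) ^ r ∂P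
        ≤ ENNReal.ofReal (C * √(n * p) ^ r)

end SparseNorm

end

noncomputable section

namespace SparseNorm

/-! Upper bound. Exponents below one follow from larger ones by Lyapunov's inequality, and centered
entries may be replaced by differences of independent copies, so the entries can be taken symmetric
with second moment at most `4 * p` and `q`-th moment `O(p)`. They are cut at the level `τ = √(n p)
n^(-1/(2q))`.

After division by `τ` the small entries are bounded by one and have variance at most `s = 4 p / τ²`,
with `n s = 4 n^(1/q)`. The trace of `(A Aᵀ)^k` expands over closed walks in a complete bipartite
graph. By symmetry only walks using every edge an even number of times survive, and each contributes
at most `s` per distinct edge, that is, up to one factor `s⁻¹`, at most `s` per distinct vertex.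
Counting walks by their pattern of coincidences shows that weighting the vertices by `s` amounts to
shrinking the graph: the moment is at most `s⁻¹` times that of a sign matrix of size `m ≥ n s + k`
(`integral_trace_pow_le_signLaw`). For `k` of order `n s` and `m = 2 k` the norm of the sign matrix
is of order `√k` in `L^(2k)` (`lintegral_specNorm_signLaw_le`), and `τ √(n s)` is of order `√(n p)`.
Polynomial prefactors disappear in the `2k`-th root because `k` grows like a power of `n`.

For the large entries the critical exponent enters: `q/2 - 1 = 1/(1-α)`, so `p ≥ c n^(-α)` gives `n
≲ (n p)^(q/2-1)`. Hence the maximal entry is `O(√(n p))` in `L^q`, and a row contains on average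
only `O(n^(-1/2))` large entries. Outside an event of polynomially small probability every row and
column has at most `d` of them, and the norm is at most `d` times the maximal entry; on that event
Hölder's inequality with `r < q` suffices (`lintegral_specNorm_largePart_le_sqrt`).

Lower bound. The norm dominates every entry. For a symmetrized Pareto law of exponent `β < q`, the
expected number of entries above `n^ν √(n p)` is a positive power of `n` when `ν` is small, because
`q (1-α)/2 = 2 - α`; by independence all entries stay below that level only with stretched
exponentially small probability. -/

/-! ### The spectral norm -/

/-- The square matrix with a given family of entries. -/
def entryMatrix {n : ℕ} (x : Fin n × Fin n → ℝ) : Matrix (Fin n) (Fin n) ℝ :=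
  Matrix.of fun i j => x (i, j)

@[simp]
lemma entryMatrix_apply {n : ℕ} (x : Fin n × Fin n → ℝ) (i j : Fin n) :
    entryMatrix x i j = x (i, j) := rfl

lemma specNorm_nonneg {n : ℕ} (A : Matrix (Fin n) (Fin n) ℝ) : 0 ≤ specNorm A := norm_nonneg _

lemma specNorm_add_le {n : ℕ} (A B : Matrix (Fin n) (Fin n) ℝ) :
    specNorm (A + B) ≤ specNorm A + specNorm B := by
  unfold specNorm
  rw [map_add]
  exact norm_add_le _ _

lemma specNorm_smul {n : ℕ} (c : ℝ) (A : Matrix (Fin n) (Fin n) ℝ) :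
    specNorm (c • A) = |c| * specNorm A := by
  unfold specNorm
  rw [map_smul, norm_smul, Real.norm_eq_abs]

lemma specNorm_pow_le {n : ℕ} (A : Matrix (Fin n) (Fin n) ℝ) {k : ℕ} (hk : 0 < k) :
    specNorm (A ^ k) ≤ specNorm A ^ k := by
  unfold specNorm
  rw [map_pow]
  exact norm_pow_le' _ hk

lemma specNorm_mul_transpose {n : ℕ} (A : Matrix (Fin n) (Fin n) ℝ) :
    specNorm (A * A.transpose) = specNorm A ^ 2 := by
  unfold specNorm
  have h : A.transpose = star A := by
    rw [Matrix.star_eq_conjTranspose, Matrix.conjTranspose_eq_transpose_of_trivial]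
  rw [h, map_mul, map_star, sq]
  exact CStarRing.norm_self_mul_star

lemma specNorm_pow_two_pow {n : ℕ} (W : Matrix (Fin n) (Fin n) ℝ) (hW : W.transpose = W) (l : ℕ) :
    specNorm (W ^ 2 ^ l) = specNorm W ^ 2 ^ l := by
  unfold specNorm
  rw [map_pow]
  refine IsSelfAdjoint.norm_pow_two_pow ?_ l
  rw [IsSelfAdjoint, ← map_star, Matrix.star_eq_conjTranspose,
    Matrix.conjTranspose_eq_transpose_of_trivial, hW]

lemma toEuclideanCLM_apply_coord {n : ℕ} (A : Matrix (Fin n) (Fin n) ℝ)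
    (x : EuclideanSpace ℝ (Fin n)) (i : Fin n) :
    Matrix.toEuclideanCLM (n := Fin n) (𝕜 := ℝ) A x i = ∑ j, A i j * x j := rfl

lemma abs_entry_le_specNorm {n : ℕ} (A : Matrix (Fin n) (Fin n) ℝ) (i j : Fin n) :
    |A i j| ≤ specNorm A := by
  have h1 := (Matrix.toEuclideanCLM (n := Fin n) (𝕜 := ℝ) A).le_opNorm (EuclideanSpace.single j 1)
  have h2 := PiLp.norm_apply_le
    (Matrix.toEuclideanCLM (n := Fin n) (𝕜 := ℝ) A (EuclideanSpace.single j 1)) i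
  rw [toEuclideanCLM_apply_coord] at h2
  simp at h1 h2
  exact h2.trans h1

lemma specNorm_le_of_norm_sq_le {n : ℕ} {A : Matrix (Fin n) (Fin n) ℝ} {c : ℝ} (hc : 0 ≤ c)
    (h : ∀ x : EuclideanSpace ℝ (Fin n),
      ∑ i, (∑ j, A i j * x j) ^ 2 ≤ c ^ 2 * ∑ j, x j ^ 2) : specNorm A ≤ c := by
  refine ContinuousLinearMap.opNorm_le_bound _ hc fun x => ?_
  refine abs_le_of_sq_le_sq' ?_ (by positivity) |>.2
  rw [mul_pow, EuclideanSpace.real_norm_sq_eq, EuclideanSpace.real_norm_sq_eq]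
  exact h x

/-- The spectral norm is at most the Hilbert-Schmidt norm. -/
lemma specNorm_sq_le_trace {n : ℕ} (B : Matrix (Fin n) (Fin n) ℝ) :
    specNorm B ^ 2 ≤ (B * B.transpose).trace := by
  have htr : (B * B.transpose).trace = ∑ i, ∑ j, B i j ^ 2 := by
    simp [Matrix.trace, Matrix.mul_apply, sq]
  have h0 : 0 ≤ (B * B.transpose).trace := by
    rw [htr]; positivity
  have h : specNorm B ≤ √(B * B.transpose).trace := by
    refine specNorm_le_of_norm_sq_le (Real.sqrt_nonneg _) fun x => ?_
    rw [Real.sq_sqrt h0, htr, Finset.sum_mul]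
    exact Finset.sum_le_sum fun i _ => Finset.sum_mul_sq_le_sq_mul_sq _ _ _
  calc specNorm B ^ 2 ≤ (√(B * B.transpose).trace) ^ 2 :=
        pow_le_pow_left₀ (specNorm_nonneg _) h 2
    _ = _ := Real.sq_sqrt h0

/-- With `W = A Aᵀ`, this is the Hilbert-Schmidt bound for the symmetric matrix `W ^ 2 ^ l`. The
C*-identity makes the norm multiplicative on its dyadic powers, which is why the orders of the
moments are powers of two below. -/
lemma specNorm_pow_le_trace {n : ℕ} (A : Matrix (Fin n) (Fin n) ℝ) (l : ℕ) :
    specNorm A ^ (2 * 2 ^ (l + 1)) ≤ ((A * A.transpose) ^ 2 ^ (l + 1)).trace := by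
  set W := A * A.transpose with hW
  have hWt : W.transpose = W := by simp [hW]
  have h := specNorm_sq_le_trace (W ^ 2 ^ l)
  rw [specNorm_pow_two_pow W hWt, Matrix.transpose_pow, hWt, ← pow_add, ← two_mul,
    specNorm_mul_transpose, ← pow_mul, ← pow_mul, ← pow_succ'] at h
  convert h using 2
  rw [pow_succ]

lemma trace_le_mul_specNorm_pow {n : ℕ} (A : Matrix (Fin n) (Fin n) ℝ) {k : ℕ} (hk : 0 < k) :
    ((A * A.transpose) ^ k).trace ≤ n * specNorm A ^ (2 * k) := by
  have h : ∀ i : Fin n, ((A * A.transpose) ^ k) i i ≤ specNorm A ^ (2 * k) := fun i => by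
    refine (le_abs_self _).trans ((abs_entry_le_specNorm _ i i).trans ?_)
    refine (specNorm_pow_le _ hk).trans ?_
    rw [specNorm_mul_transpose, pow_mul]
  calc ((A * A.transpose) ^ k).trace = ∑ i, ((A * A.transpose) ^ k) i i := rfl
    _ ≤ ∑ _i : Fin n, specNorm A ^ (2 * k) := Finset.sum_le_sum fun i _ => h i
    _ = _ := by simp

/-- A matrix with entries bounded by `m` and at most `d` nonzero entries in each row and column
has spectral norm at most `m * d`. -/
lemma specNorm_le_mul_of_card_le {n : ℕ} {A : Matrix (Fin n) (Fin n) ℝ} {m : ℝ} {d : ℕ}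
    (hm : 0 ≤ m) (hA : ∀ i j, |A i j| ≤ m)
    (hrow : ∀ i, (Finset.univ.filter fun j => A i j ≠ 0).card ≤ d)
    (hcol : ∀ j, (Finset.univ.filter fun i => A i j ≠ 0).card ≤ d) :
    specNorm A ≤ m * d := by
  refine specNorm_le_of_norm_sq_le (by positivity) fun x => ?_
  -- Cauchy-Schwarz over the support of row `i` costs one factor `d`; the second comes from the
  -- column sums of squares in `h2`.
  have h1 : ∀ i, (∑ j, A i j * x j) ^ 2 ≤ d * ∑ j, A i j ^ 2 * x j ^ 2 := fun i => by
    have : ∑ j, A i j * x j = ∑ j ∈ Finset.univ.filter (fun j => A i j ≠ 0), A i j * x j := by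
      rw [Finset.sum_filter]
      exact Finset.sum_congr rfl fun j _ => by by_cases h : A i j = 0 <;> simp [h]
    rw [this]
    refine sq_sum_le_card_mul_sum_sq.trans ?_
    gcongr
    · exact hrow i
    · rw [Finset.sum_filter]
      exact Finset.sum_le_sum fun j _ => by split_ifs <;> nlinarith [sq_nonneg (A i j * x j)]
  have h2 : ∀ j, ∑ i, A i j ^ 2 ≤ d * m ^ 2 := fun j => by
    have : ∑ i, A i j ^ 2 = ∑ i ∈ Finset.univ.filter (fun i => A i j ≠ 0), A i j ^ 2 := by
      rw [Finset.sum_filter]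
      exact Finset.sum_congr rfl fun i _ => by by_cases h : A i j = 0 <;> simp [h]
    rw [this]
    calc _ ≤ ∑ i ∈ Finset.univ.filter (fun i => A i j ≠ 0), m ^ 2 :=
          Finset.sum_le_sum fun i _ => by
            rw [← sq_abs]; exact pow_le_pow_left₀ (abs_nonneg _) (hA i j) 2
      _ = ((Finset.univ.filter fun i => A i j ≠ 0).card : ℝ) * m ^ 2 := by simp
      _ ≤ _ := by gcongr; exact hcol j
  calc ∑ i, (∑ j, A i j * x j) ^ 2 ≤ ∑ i, d * ∑ j, A i j ^ 2 * x j ^ 2 :=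
        Finset.sum_le_sum fun i _ => h1 i
    _ = d * ∑ j, (∑ i, A i j ^ 2) * x j ^ 2 := by
        rw [← Finset.mul_sum, Finset.sum_comm]; simp [Finset.sum_mul]
    _ ≤ d * ∑ j, (d * m ^ 2) * x j ^ 2 := by gcongr; exact h2 _
    _ = _ := by rw [← Finset.mul_sum]; ring

lemma continuous_specNorm_entryMatrix {n : ℕ} :
    Continuous fun x : Fin n × Fin n → ℝ => specNorm (entryMatrix x) := by
  have h : Continuous fun x : Fin n × Fin n → ℝ => (entryMatrix x : Matrix (Fin n) (Fin n) ℝ) :=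
    continuous_matrix fun i j => continuous_apply (i, j)
  have h2 : Continuous fun A : Matrix (Fin n) (Fin n) ℝ =>
      Matrix.toEuclideanCLM (n := Fin n) (𝕜 := ℝ) A :=
    LinearMap.continuous_of_finiteDimensional
      ((Matrix.toEuclideanCLM (n := Fin n) (𝕜 := ℝ)).toAlgEquiv.toLinearMap)
  exact continuous_norm.comp (h2.comp h)

lemma measurable_specNorm_entryMatrix {n : ℕ} :
    Measurable fun x : Fin n × Fin n → ℝ => specNorm (entryMatrix x) :=
  continuous_specNorm_entryMatrix.measurable

/-! ### Expansion of traces of powers over closed walks -/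

/-- The factor `V` is kept apart so that only `k + 1` vertices are summed over. With `V = W` and `b
= a` the last step closes the walk, and in `trace_pow_eq_sum` the index `l + 1` wraps around in `Fin
(k + 1)`. -/
lemma matrix_pow_mul_apply {ι : Type*} [Fintype ι] [DecidableEq ι] (W V : Matrix ι ι ℝ) (k : ℕ)
    (a b : ι) :
    (W ^ k * V) a b = ∑ I : Fin (k + 1) → ι, if I 0 = a then
      (∏ l : Fin k, W (I l.castSucc) (I l.succ)) * V (I (Fin.last k)) b else 0 := by
  induction k generalizing a with
  | zero =>
    rw [← (Equiv.funUnique (Fin 1) ι).symm.sum_comp]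
    simp
  | succ k ih =>
    rw [pow_succ', mul_assoc, Matrix.mul_apply]
    simp_rw [ih]
    rw [← (Fin.consEquiv fun _ => ι).sum_comp, Fintype.sum_prod_type]
    simp only [Fin.consEquiv_apply, Fin.cons_zero, Fin.prod_univ_succ (n := k), Fin.castSucc_zero,
      Fin.cons_succ, ← Fin.succ_castSucc, ← Fin.succ_last]
    simp only [Finset.mul_sum, mul_ite, mul_zero]
    rw [Finset.sum_comm]
    conv_rhs => rw [Finset.sum_comm]
    refine Finset.sum_congr rfl fun I _ => ?_
    simp [mul_assoc]

lemma trace_pow_eq_sum {ι : Type*} [Fintype ι] [DecidableEq ι] (W : Matrix ι ι ℝ) (k : ℕ) :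
    (W ^ (k + 1)).trace = ∑ I : Fin (k + 1) → ι, ∏ l, W (I l) (I (l + 1)) := by
  rw [pow_succ, Matrix.trace]
  simp_rw [Matrix.diag_apply, matrix_pow_mul_apply]
  rw [Finset.sum_comm]
  refine Finset.sum_congr rfl fun I _ => ?_
  rw [Fin.prod_univ_castSucc]
  simp

/-- The edges of the closed walk `I 0, J 0, I 1, J 1, …` in the complete bipartite graph. -/
def walkEdge {n k : ℕ} (I J : Fin (k + 1) → Fin n) : Fin (k + 1) ⊕ Fin (k + 1) → Fin n × Fin n :=
  Sum.elim (fun l => (I l, J l)) (fun l => (I (l + 1), J l))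

lemma trace_pow_eq_sum_walkEdge {n : ℕ} (x : Fin n × Fin n → ℝ) (k : ℕ) :
    ((entryMatrix x * (entryMatrix x).transpose) ^ (k + 1)).trace =
      ∑ I : Fin (k + 1) → Fin n, ∑ J : Fin (k + 1) → Fin n, ∏ a, x (walkEdge I J a) := by
  rw [trace_pow_eq_sum]
  refine Finset.sum_congr rfl fun I _ => ?_
  simp_rw [Matrix.mul_apply, Matrix.transpose_apply, entryMatrix_apply]
  rw [Finset.prod_univ_sum, Fintype.piFinset_univ]
  refine Finset.sum_congr rfl fun J _ => ?_
  rw [Fintype.prod_sum_type, ← Finset.prod_mul_distrib]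
  rfl

/-- The number of times a walk uses the edge `e`. -/
def edgeMult {n k : ℕ} (I J : Fin (k + 1) → Fin n) (e : Fin n × Fin n) : ℕ :=
  (Finset.univ.filter fun a => walkEdge I J a = e).card

/-- Every edge of the walk is used an even number of times. -/
def IsEvenWalk {n k : ℕ} (I J : Fin (k + 1) → Fin n) : Prop :=
  ∀ a, Even (edgeMult I J (walkEdge I J a))

lemma isEvenWalk_iff {n k : ℕ} (I J : Fin (k + 1) → Fin n) :
    IsEvenWalk I J ↔ ∀ e, Even (edgeMult I J e) := by
  refine ⟨fun h e => ?_, fun h a => h _⟩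
  by_cases he : ∃ a, walkEdge I J a = e
  · obtain ⟨a, rfl⟩ := he; exact h a
  · push Not at he
    simp [edgeMult, Finset.filter_false_of_mem fun a _ => he a]

lemma edgeMult_eq_zero_iff {n k : ℕ} (I J : Fin (k + 1) → Fin n) (e : Fin n × Fin n) :
    edgeMult I J e = 0 ↔ e ∉ Finset.univ.image (walkEdge I J) := by
  simp [edgeMult, Finset.filter_eq_empty_iff]

lemma prod_walkEdge_eq {n k : ℕ} (I J : Fin (k + 1) → Fin n) (x : Fin n × Fin n → ℝ) :
    ∏ a, x (walkEdge I J a) = ∏ e, x e ^ edgeMult I J e := by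
  rw [← Finset.prod_fiberwise (g := walkEdge I J)]
  refine Finset.prod_congr rfl fun e _ => ?_
  rw [edgeMult, ← Finset.prod_const]
  exact Finset.prod_congr rfl fun a ha => by rw [(Finset.mem_filter.mp ha).2]

lemma integral_prod_walkEdge {n k : ℕ} (ν : Measure ℝ) [IsProbabilityMeasure ν]
    (I J : Fin (k + 1) → Fin n) :
    ∫ x, ∏ a, x (walkEdge I J a) ∂(Measure.pi fun _ : Fin n × Fin n => ν) =
      ∏ e, ∫ y, y ^ edgeMult I J e ∂ν := by
  simp_rw [prod_walkEdge_eq]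
  exact integral_fintype_prod_eq_prod (fun e y => y ^ edgeMult I J e) (μ := fun _ => ν)

lemma integrable_pow_of_bounded {ν : Measure ℝ} [IsProbabilityMeasure ν]
    (hb : ∀ᵐ y ∂ν, |y| ≤ 1) (m : ℕ) : Integrable (fun y : ℝ => y ^ m) ν := by
  refine Integrable.of_bound (by fun_prop) 1 ?_
  filter_upwards [hb] with y hy
  rw [norm_pow]
  exact pow_le_one₀ (norm_nonneg _) hy

lemma integrable_prod_walkEdge {n k : ℕ} {ν : Measure ℝ} [IsProbabilityMeasure ν]
    (hb : ∀ᵐ y ∂ν, |y| ≤ 1) (I J : Fin (k + 1) → Fin n) :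
    Integrable (fun x : Fin n × Fin n → ℝ => ∏ a, x (walkEdge I J a))
      (Measure.pi fun _ : Fin n × Fin n => ν) := by
  simp_rw [prod_walkEdge_eq]
  exact Integrable.fintype_prod (f := fun e y => y ^ edgeMult I J e) (μ := fun _ => ν)
    fun e => integrable_pow_of_bounded hb _

lemma integral_pow_odd_eq_zero {ν : Measure ℝ} (hs : ν.map (fun y => -y) = ν) {m : ℕ}
    (hm : Odd m) : ∫ y, y ^ m ∂ν = 0 := by
  have h : ∫ y, y ^ m ∂ν = ∫ y, (-y) ^ m ∂ν := by
    conv_lhs => rw [← hs]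
    exact integral_map (by fun_prop) (by fun_prop)
  simp_rw [hm.neg_pow, integral_neg] at h
  linarith

lemma integral_pow_even_le {ν : Measure ℝ} [IsProbabilityMeasure ν] (hb : ∀ᵐ y ∂ν, |y| ≤ 1)
    {s : ℝ} (hv : ∫ y, y ^ 2 ∂ν ≤ s) {m : ℕ} (hm : Even m) (h0 : m ≠ 0) :
    ∫ y, y ^ m ∂ν ≤ s := by
  refine (integral_mono_ae (integrable_pow_of_bounded hb m) (integrable_pow_of_bounded hb 2)
    ?_).trans hv
  filter_upwards [hb] with y hy
  have h2 : 2 ≤ m := by obtain ⟨c, rfl⟩ := hm; omega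
  rw [← hm.pow_abs, ← sq_abs y]
  exact pow_le_pow_of_le_one (abs_nonneg _) hy h2

-- Independence factors the expectation over distinct edges. An odd multiplicity gives zero by
-- symmetry; a positive even one is at least two, so `|y| ≤ 1` bounds that moment by the second one.
open Classical in
lemma integral_prod_walkEdge_le {n k : ℕ} {ν : Measure ℝ} [IsProbabilityMeasure ν]
    (hsymm : ν.map (fun y => -y) = ν) (hb : ∀ᵐ y ∂ν, |y| ≤ 1) {s : ℝ}
    (hv : ∫ y, y ^ 2 ∂ν ≤ s) (I J : Fin (k + 1) → Fin n) :
    ∫ x, ∏ a, x (walkEdge I J a) ∂(Measure.pi fun _ : Fin n × Fin n => ν) ≤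
      if IsEvenWalk I J then s ^ (Finset.univ.image (walkEdge I J)).card else 0 := by
  rw [integral_prod_walkEdge]
  split_ifs with h
  · rw [isEvenWalk_iff] at h
    calc ∏ e, ∫ y, y ^ edgeMult I J e ∂ν
        ≤ ∏ e, if e ∈ Finset.univ.image (walkEdge I J) then s else 1 := by
          refine Finset.prod_le_prod (fun e _ => integral_nonneg fun y => (h e).pow_nonneg y)
            fun e _ => ?_
          split_ifs with he
          · exact integral_pow_even_le hb hv (h e)
              fun h0 => (edgeMult_eq_zero_iff I J e).mp h0 he
          · rw [(edgeMult_eq_zero_iff I J e).mpr he]; simp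
      _ = _ := by rw [Finset.prod_ite_mem, Finset.univ_inter, Finset.prod_const]
  · rw [isEvenWalk_iff] at h
    push Not at h
    obtain ⟨e, he⟩ := h
    exact (Finset.prod_eq_zero (Finset.mem_univ e)
      (integral_pow_odd_eq_zero hsymm (Nat.not_even_iff_odd.mp he))).le

/-- In a connected walk the number of vertices is at most one more than the number of edges. -/
lemma card_image_add_card_image_le {α β : Type*} [DecidableEq α] [DecidableEq β]
    (I : ℕ → α) (J : ℕ → β) (t : ℕ) :
    ((Finset.range (t + 1)).image I).card + ((Finset.range t).image J).card ≤
      ((Finset.range t).image (fun l => (I l, J l)) ∪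
        (Finset.range t).image (fun l => (I (l + 1), J l))).card + 1 := by
  induction t with
  | zero => simp
  | succ t ih =>
    set E := (Finset.range t).image (fun l => (I l, J l)) ∪
      (Finset.range t).image (fun l => (I (l + 1), J l)) with hE
    have hE' : (Finset.range (t + 1)).image (fun l => (I l, J l)) ∪
        (Finset.range (t + 1)).image (fun l => (I (l + 1), J l)) =
        insert (I (t + 1), J t) (insert (I t, J t) E) := by
      rw [Finset.range_add_one, Finset.image_insert, Finset.image_insert, hE]
      ext e; simp only [Finset.mem_union, Finset.mem_insert]; tauto
    rw [hE', Finset.range_add_one (n := t + 1), Finset.image_insert]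
    set VI := (Finset.range (t + 1)).image I with hVI
    rw [Finset.range_add_one, Finset.image_insert]
    set VJ := (Finset.range t).image J with hVJ
    -- The walk grows by two half steps, first to `J t`, then to `I (t + 1)`. A half step reaching a
    -- new vertex necessarily uses a new edge.
    have h1 : VI.card + (insert (J t) VJ).card ≤ (insert (I t, J t) E).card + 1 := by
      by_cases hJ : J t ∈ VJ
      · rw [Finset.insert_eq_of_mem hJ]
        exact ih.trans (by gcongr; exact Finset.subset_insert _ _)
      · have hne : (I t, J t) ∉ E := by
          intro hmem
          apply hJ
          simp only [hE, Finset.mem_union, Finset.mem_image, Prod.mk.injEq] at hmem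
          rw [hVJ, Finset.mem_image]
          rcases hmem with ⟨l, hl, -, h⟩ | ⟨l, hl, -, h⟩ <;> exact ⟨l, hl, h⟩
        rw [Finset.card_insert_of_notMem hJ, Finset.card_insert_of_notMem hne]
        omega
    by_cases hI : I (t + 1) ∈ VI
    · rw [Finset.insert_eq_of_mem hI]
      exact h1.trans (by gcongr; exact Finset.subset_insert _ _)
    · have hne : (I (t + 1), J t) ∉ insert (I t, J t) E := by
        intro hmem
        apply hI
        simp only [hE, Finset.mem_insert, Finset.mem_union, Finset.mem_image, Prod.mk.injEq] at hmem
        rw [hVI, Finset.mem_image]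
        rcases hmem with ⟨h, -⟩ | ⟨l, hl, h, -⟩ | ⟨l, hl, h, -⟩
        · exact ⟨t, by simp, h.symm⟩
        · exact ⟨l, by simp at hl ⊢; omega, h⟩
        · exact ⟨l + 1, by simp at hl ⊢; omega, h⟩
      rw [Finset.card_insert_of_notMem hI, Finset.card_insert_of_notMem hne]
      omega

lemma card_image_add_card_image_le_walkEdge {n k : ℕ} (I J : Fin (k + 1) → Fin n) :
    (Finset.univ.image I).card + (Finset.univ.image J).card ≤
      (Finset.univ.image (walkEdge I J)).card + 1 := by
  have h := card_image_add_card_image_le (fun l : ℕ => I (Fin.ofNat (k + 1) l))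
    (fun l : ℕ => J (Fin.ofNat (k + 1) l)) (k + 1)
  have hcast : ∀ l : Fin (k + 1), Fin.ofNat (k + 1) l.val = l := fun l => by simp
  refine (add_le_add (Finset.card_le_card ?_) (Finset.card_le_card ?_)).trans
    (h.trans (Nat.add_le_add_right (Finset.card_le_card ?_) 1))
  · intro v hv
    obtain ⟨l, -, rfl⟩ := Finset.mem_image.mp hv
    exact Finset.mem_image.mpr ⟨l, Finset.mem_range.mpr (by omega), by rw [hcast]⟩
  · intro v hv
    obtain ⟨l, -, rfl⟩ := Finset.mem_image.mp hv
    exact Finset.mem_image.mpr ⟨l, Finset.mem_range.mpr l.2, by rw [hcast]⟩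
  · intro e he
    rw [Finset.mem_union] at he
    rcases he with he | he
    · obtain ⟨l, -, rfl⟩ := Finset.mem_image.mp he
      exact Finset.mem_image.mpr ⟨Sum.inl (Fin.ofNat (k + 1) l), by simp, rfl⟩
    · obtain ⟨l, -, rfl⟩ := Finset.mem_image.mp he
      refine Finset.mem_image.mpr ⟨Sum.inr (Fin.ofNat (k + 1) l), by simp, ?_⟩
      simp only [walkEdge, Sum.elim_inr, Prod.mk.injEq, and_true]
      congr 1
      ext
      simp [Fin.val_add]

/-! ### Comparison of walks in complete bipartite graphs of different sizes -/

/-- Functions with kernel `π` correspond to embeddings of the quotient by `π`. -/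
def kerEquivEmbedding {α β : Type*} (π : Setoid α) :
    {f : α → β // Setoid.ker f = π} ≃ (Quotient π ↪ β) where
  toFun f := ⟨Quotient.lift f.1 fun a b hab => by
      have : Setoid.ker f.1 a b := by rw [f.2]; exact hab
      exact this, by
    intro a b
    induction a using Quotient.inductionOn
    induction b using Quotient.inductionOn
    intro h
    refine Quotient.sound ?_
    have : Setoid.ker f.1 _ _ := h
    rw [f.2] at this
    exact this⟩
  invFun g := ⟨fun a => g (Quotient.mk π a), by
    ext a b
    rw [Setoid.ker_def, g.injective.eq_iff]
    exact Quotient.eq⟩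
  left_inv f := rfl
  right_inv g := by
    ext a
    induction a using Quotient.inductionOn
    rfl

open Classical in
lemma card_filter_ker_eq {α : Type*} [Fintype α] (n : ℕ) (π : Setoid α) :
    (Finset.univ.filter fun f : α → Fin n => Setoid.ker f = π).card =
      n.descFactorial (Fintype.card (Quotient π)) := by
  rw [← Fintype.card_subtype, Fintype.card_congr (kerEquivEmbedding π), Fintype.card_embedding_eq,
    Fintype.card_fin]

open Classical in
lemma card_quotient_ker {α β : Type*} [Fintype α] (f : α → β) :
    Fintype.card (Quotient (Setoid.ker f)) = (Finset.univ.image f).card := by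
  rw [Fintype.card_congr (Setoid.quotientKerEquivRange f), ← Set.toFinset_card, Set.toFinset_range]

-- Grouping functions by kernel reduces this to `s ^ v * (n)_v ≤ (m)_v` (falling factorials) for
-- kernels with `v ≤ k` classes, and `(n s)^v ≤ (m - k)^v ≤ (m + 1 - v)^v ≤ (m)_v`.
open Classical in
lemma sum_pow_card_image_mul_le {k n m : ℕ} {s : ℝ} (hs : 0 ≤ s) (hm : n * s + k ≤ m)
    (F : Setoid (Fin k) → ℝ) (hF : ∀ π, 0 ≤ F π) :
    ∑ I : Fin k → Fin n, s ^ (Finset.univ.image I).card * F (Setoid.ker I) ≤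
      ∑ I : Fin k → Fin m, F (Setoid.ker I) := by
  have : Finite (Setoid (Fin k)) :=
    Finite.of_injective (fun π : Setoid (Fin k) => fun a b => π a b) fun π σ h => by
      ext a b; exact iff_of_eq (congrFun (congrFun h a) b)
  let _ : Fintype (Setoid (Fin k)) := Fintype.ofFinite _
  have key : ∀ (N : ℕ) (G : Setoid (Fin k) → ℝ), ∑ I : Fin k → Fin N, G (Setoid.ker I) =
      ∑ π, (N.descFactorial (Fintype.card (Quotient π)) : ℝ) * G π := fun N G => by
    rw [← Finset.sum_fiberwise (g := fun I : Fin k → Fin N => Setoid.ker I)]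
    refine Finset.sum_congr rfl fun π _ => ?_
    rw [← card_filter_ker_eq, ← nsmul_eq_mul, ← Finset.sum_const]
    refine Finset.sum_congr (by congr!) fun I hI => by rw [(Finset.mem_filter.mp hI).2]
  have h1 : ∀ I : Fin k → Fin n, s ^ (Finset.univ.image I).card * F (Setoid.ker I) =
      (fun π => s ^ Fintype.card (Quotient π) * F π) (Setoid.ker I) := fun I => by
    simp only
    rw [card_quotient_ker]
    congr!
  have hn := key n fun π => s ^ Fintype.card (Quotient π) * F π
  have hm' := key m F
  refine Eq.trans_le (Eq.trans ?_ hn) (le_trans ?_ (Eq.le (Eq.trans hm'.symm ?_)))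
  rotate_left
  rotate_left
  · congr!
  · exact Finset.sum_congr (by congr!) fun I _ => h1 I
  refine Finset.sum_le_sum fun π _ => ?_
  rw [← mul_assoc]
  refine mul_le_mul_of_nonneg_right ?_ (hF π)
  set v := Fintype.card (Quotient π)
  have hv : v ≤ k := by
    simpa using Fintype.card_quotient_le π
  have hkm : k ≤ m := by
    have : (k : ℝ) ≤ m := le_trans (by nlinarith [mul_nonneg (Nat.cast_nonneg (α := ℝ) n) hs]) hm
    exact_mod_cast this
  calc (n.descFactorial v : ℝ) * s ^ v ≤ (n : ℝ) ^ v * s ^ v := by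
        gcongr
        exact_mod_cast Nat.descFactorial_le_pow n v
    _ = (n * s) ^ v := (mul_pow _ _ _).symm
    _ ≤ ((m + 1 - v : ℕ) : ℝ) ^ v := by
        gcongr
        have : ((m - k : ℕ) : ℝ) ≤ ((m + 1 - v : ℕ) : ℝ) := by
          exact_mod_cast (by omega : m - k ≤ m + 1 - v)
        rw [Nat.cast_sub hkm] at this
        linarith
    _ ≤ m.descFactorial v := by exact_mod_cast Nat.pow_sub_le_descFactorial m v

/-- Edge multiplicities only see which indices coincide, so evenness makes sense across vertex sets
of different sizes. -/
lemma isEvenWalk_congr {n m k : ℕ} {I J : Fin (k + 1) → Fin n} {I' J' : Fin (k + 1) → Fin m}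
    (hI : Setoid.ker I = Setoid.ker I') (hJ : Setoid.ker J = Setoid.ker J') :
    IsEvenWalk I J ↔ IsEvenWalk I' J' := by
  have hI' : ∀ a b, I a = I b ↔ I' a = I' b := fun a b => by
    rw [← Setoid.ker_def, hI, Setoid.ker_def]
  have hJ' : ∀ a b, J a = J b ↔ J' a = J' b := fun a b => by
    rw [← Setoid.ker_def, hJ, Setoid.ker_def]
  have h : ∀ a b, walkEdge I J b = walkEdge I J a ↔ walkEdge I' J' b = walkEdge I' J' a := by
    rintro (a | a) (b | b) <;> simp [walkEdge, hI', hJ']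
  simp only [IsEvenWalk, edgeMult, h]

/-- Walks whose vertex sequences have kernels `π` and `σ` are even. -/
def IsEvenKer {k : ℕ} (π σ : Setoid (Fin (k + 1))) : Prop :=
  ∀ (n : ℕ) (I J : Fin (k + 1) → Fin n), Setoid.ker I = π → Setoid.ker J = σ → IsEvenWalk I J

lemma isEvenKer_iff {n k : ℕ} (I J : Fin (k + 1) → Fin n) :
    IsEvenKer (Setoid.ker I) (Setoid.ker J) ↔ IsEvenWalk I J :=
  ⟨fun h => h n I J rfl rfl, fun h _ _ _ hI hJ => (isEvenWalk_congr hI hJ).mpr h⟩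

-- `sum_pow_card_image_mul_le` is applied to one side of the bipartite graph at a time. The
-- intermediate sum has `I` in `Fin n` and `J` in `Fin m`, hence evenness is expressed through the
-- two kernels.
open Classical in
lemma sum_even_pow_le {k n m : ℕ} {s : ℝ} (hs : 0 ≤ s) (hm : n * s + (k + 1 : ℕ) ≤ m) :
    ∑ I : Fin (k + 1) → Fin n, ∑ J : Fin (k + 1) → Fin n,
      (if IsEvenWalk I J then
        s ^ ((Finset.univ.image I).card + (Finset.univ.image J).card) else 0) ≤
    ∑ I : Fin (k + 1) → Fin m, ∑ J : Fin (k + 1) → Fin m, if IsEvenWalk I J then (1 : ℝ) else 0 := by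
  set E : Setoid (Fin (k + 1)) → Setoid (Fin (k + 1)) → ℝ :=
    fun π σ => if IsEvenKer π σ then 1 else 0 with hE
  have hE0 : ∀ π σ, 0 ≤ E π σ := fun π σ => by simp only [hE]; split_ifs <;> simp
  have h1 : ∀ I J : Fin (k + 1) → Fin n, (if IsEvenWalk I J then
      s ^ ((Finset.univ.image I).card + (Finset.univ.image J).card) else 0) =
      s ^ (Finset.univ.image I).card *
        (s ^ (Finset.univ.image J).card * E (Setoid.ker I) (Setoid.ker J)) := fun I J => by
    simp only [hE, isEvenKer_iff]
    split_ifs <;> simp [pow_add]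
  have h2 : ∀ I J : Fin (k + 1) → Fin m, (if IsEvenWalk I J then (1 : ℝ) else 0) =
      E (Setoid.ker I) (Setoid.ker J) := fun I J => by simp only [hE, isEvenKer_iff]
  simp_rw [h1, h2, ← Finset.mul_sum]
  calc _ ≤ ∑ I : Fin (k + 1) → Fin n, s ^ (Finset.univ.image I).card *
        ∑ J : Fin (k + 1) → Fin m, E (Setoid.ker I) (Setoid.ker J) := by
        refine Finset.sum_le_sum fun I _ => mul_le_mul_of_nonneg_left ?_ (by positivity)
        convert sum_pow_card_image_mul_le hs hm (E (Setoid.ker I)) (hE0 _)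
    _ ≤ _ := by
        convert sum_pow_card_image_mul_le hs hm
          (fun π => ∑ J : Fin (k + 1) → Fin m, E π (Setoid.ker J))
          (fun π => Finset.sum_nonneg fun J _ => hE0 _ _)

/-- The law of a uniform random sign. -/
def signLaw : Measure ℝ :=
  (2⁻¹ : ℝ≥0∞) • Measure.dirac 1 + (2⁻¹ : ℝ≥0∞) • Measure.dirac (-1)

instance : IsProbabilityMeasure signLaw :=
  ⟨by simp [signLaw, ENNReal.inv_two_add_inv_two]⟩

lemma integral_signLaw (f : ℝ → ℝ) : ∫ y, f y ∂signLaw = (f 1 + f (-1)) / 2 := by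
  rw [signLaw, integral_add_measure, integral_smul_measure, integral_smul_measure, integral_dirac,
    integral_dirac]
  · simp; ring
  · exact (integrable_dirac (by simp)).smul_measure (by simp)
  · exact (integrable_dirac (by simp)).smul_measure (by simp)

lemma abs_le_one_signLaw : ∀ᵐ y ∂signLaw, |y| ≤ 1 := by
  rw [signLaw, ae_add_measure_iff]
  constructor <;> refine Measure.ae_smul_measure ?_ _ <;> rw [ae_dirac_eq] <;> simp

lemma integral_signLaw_pow (m : ℕ) : ∫ y, y ^ m ∂signLaw = if Even m then 1 else 0 := by
  rw [integral_signLaw]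
  split_ifs with h
  · simp [h.neg_pow]
  · simp [(Nat.not_even_iff_odd.mp h).neg_pow]

-- For signs, the expected trace counts the even walks exactly, so that the count in the smaller
-- graph is again a trace moment.
open Classical in
lemma integral_signLaw_prod_walkEdge {n k : ℕ} (I J : Fin (k + 1) → Fin n) :
    ∫ x, ∏ a, x (walkEdge I J a) ∂(Measure.pi fun _ : Fin n × Fin n => signLaw) =
      if IsEvenWalk I J then 1 else 0 := by
  rw [integral_prod_walkEdge]
  simp_rw [integral_signLaw_pow, isEvenWalk_iff]
  split_ifs with h
  · exact Finset.prod_eq_one fun e _ => by rw [if_pos (h e)]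
  · push Not at h
    obtain ⟨e, he⟩ := h
    exact Finset.prod_eq_zero (Finset.mem_univ e) (if_neg he)

lemma integrable_trace_pow {n k : ℕ} {ν : Measure ℝ} [IsProbabilityMeasure ν]
    (hb : ∀ᵐ y ∂ν, |y| ≤ 1) :
    Integrable (fun x : Fin n × Fin n → ℝ =>
      ((entryMatrix x * (entryMatrix x).transpose) ^ (k + 1)).trace)
      (Measure.pi fun _ : Fin n × Fin n => ν) := by
  simp_rw [trace_pow_eq_sum_walkEdge]
  exact integrable_finsetSum _ fun I _ => integrable_finsetSum _ fun J _ =>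
    integrable_prod_walkEdge hb I J

lemma integral_trace_pow {n k : ℕ} {ν : Measure ℝ} [IsProbabilityMeasure ν]
    (hb : ∀ᵐ y ∂ν, |y| ≤ 1) :
    ∫ x, ((entryMatrix x * (entryMatrix x).transpose) ^ (k + 1)).trace
      ∂(Measure.pi fun _ : Fin n × Fin n => ν) =
    ∑ I : Fin (k + 1) → Fin n, ∑ J : Fin (k + 1) → Fin n,
      ∫ x, ∏ a, x (walkEdge I J a) ∂(Measure.pi fun _ : Fin n × Fin n => ν) := by
  simp_rw [trace_pow_eq_sum_walkEdge]
  rw [integral_finsetSum _ fun I _ => integrable_finsetSum _ fun J _ =>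
    integrable_prod_walkEdge hb I J]
  exact Finset.sum_congr rfl fun I _ => integral_finsetSum _ fun J _ =>
    integrable_prod_walkEdge hb I J

/-- Trace moments of a matrix with independent symmetric entries of small variance are dominated by
those of a smaller matrix of independent signs. -/
lemma integral_trace_pow_le_signLaw {n m k : ℕ} {ν : Measure ℝ} [IsProbabilityMeasure ν]
    (hsymm : ν.map (fun y => -y) = ν) (hb : ∀ᵐ y ∂ν, |y| ≤ 1) {s : ℝ} (hs0 : 0 < s) (hs1 : s ≤ 1)
    (hv : ∫ y, y ^ 2 ∂ν ≤ s) (hm : n * s + (k + 1 : ℕ) ≤ m) :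
    ∫ x, ((entryMatrix x * (entryMatrix x).transpose) ^ (k + 1)).trace
      ∂(Measure.pi fun _ : Fin n × Fin n => ν) ≤
    s⁻¹ * ∫ x, ((entryMatrix x * (entryMatrix x).transpose) ^ (k + 1)).trace
      ∂(Measure.pi fun _ : Fin m × Fin m => signLaw) := by
  classical
  rw [integral_trace_pow hb, integral_trace_pow abs_le_one_signLaw]
  simp_rw [integral_signLaw_prod_walkEdge]
  refine le_trans ?_ (mul_le_mul_of_nonneg_left (sum_even_pow_le hs0.le hm) (by positivity))
  rw [Finset.mul_sum]
  refine Finset.sum_le_sum fun I _ => ?_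
  rw [Finset.mul_sum]
  refine Finset.sum_le_sum fun J _ => (integral_prod_walkEdge_le hsymm hb hv I J).trans ?_
  split_ifs
  -- A connected graph may have one edge fewer than vertices; the factor `s⁻¹` pays for it.
  · rw [le_inv_mul_iff₀ hs0, ← pow_succ']
    exact pow_le_pow_of_le_one hs0.le hs1 (card_image_add_card_image_le_walkEdge I J)
  · simp

/-! ### The norm of a matrix of independent signs -/

/-- A power of the operator norm is bounded by an average over the unit ball. -/
lemma volume_mul_enorm_pow_le {r : ℕ} {F : Type*} [NormedAddCommGroup F] [NormedSpace ℝ F]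
    (T : EuclideanSpace ℝ (Fin r) →L[ℝ] F) (N : ℕ) :
    volume (Metric.closedBall (0 : EuclideanSpace ℝ (Fin r)) 1) * ‖T‖ₑ ^ N ≤
      4 ^ (N + r) * ∫⁻ v in Metric.closedBall (0 : EuclideanSpace ℝ (Fin r)) 1, ‖T v‖ₑ ^ N := by
  obtain ⟨w, hw, hTw⟩ : ∃ w : EuclideanSpace ℝ (Fin r), ‖w‖ ≤ 1 ∧ 2 / 3 * ‖T‖ ≤ ‖T w‖ := by
    rcases eq_or_ne T 0 with rfl | hT
    · exact ⟨0, by simp, by simp⟩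
    · obtain ⟨w, hw, h⟩ := T.exists_lt_apply_of_lt_opNorm (r := 2 / 3 * ‖T‖)
        (by linarith [norm_pos_iff.mpr hT])
      exact ⟨w, hw.le, h.le⟩
  -- This ball lies in the unit ball, and on it `‖T v‖ ≥ (3/4 · 2/3 - 1/4) ‖T‖ = ‖T‖ / 4`.
  set S := Metric.closedBall ((3 / 4 : ℝ) • w) (1 / 4) with hS
  have hsub : S ⊆ Metric.closedBall 0 1 := by
    refine Metric.closedBall_subset_closedBall' ?_
    rw [dist_zero_right, norm_smul, Real.norm_of_nonneg (by norm_num)]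
    linarith
  have hlow : ∀ v ∈ S, ENNReal.ofReal (‖T‖ / 4) ^ N ≤ ‖T v‖ₑ ^ N := fun v hv => by
    gcongr
    rw [← ofReal_norm]
    refine ENNReal.ofReal_le_ofReal ?_
    have h1 : ‖T v - T ((3 / 4 : ℝ) • w)‖ ≤ ‖T‖ * (1 / 4) := by
      rw [← map_sub]
      refine (T.le_opNorm _).trans (mul_le_mul_of_nonneg_left ?_ (norm_nonneg _))
      rwa [← dist_eq_norm]
    have h2 : ‖T ((3 / 4 : ℝ) • w)‖ = 3 / 4 * ‖T w‖ := by
      rw [map_smul, norm_smul, Real.norm_of_nonneg (by norm_num)]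
    have h3 := norm_sub_norm_le (T ((3 / 4 : ℝ) • w)) (T v)
    rw [norm_sub_rev] at h3
    linarith
  have hvol : volume S = ENNReal.ofReal ((1 / 4) ^ r) *
      volume (Metric.closedBall (0 : EuclideanSpace ℝ (Fin r)) 1) := by
    rw [hS, Measure.addHaar_closedBall' _ _ (by norm_num), finrank_euclideanSpace_fin]
  have h4 : (4 : ℝ≥0∞) ^ (N + r) * (ENNReal.ofReal ((1 / 4) ^ r) * ENNReal.ofReal (‖T‖ / 4) ^ N) =
      ‖T‖ₑ ^ N := by
    rw [← ofReal_norm, ← ENNReal.ofReal_pow (by positivity), ← ENNReal.ofReal_pow (by positivity),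
      ← ENNReal.ofReal_mul (by positivity), ← ENNReal.ofReal_ofNat 4,
      ← ENNReal.ofReal_pow (by positivity), ← ENNReal.ofReal_mul (by positivity)]
    congr 1
    rw [div_pow, div_pow, one_pow, pow_add]
    change (4 : ℝ) ^ N * 4 ^ r * (1 / 4 ^ r * (‖T‖ ^ N / 4 ^ N)) = _
    field_simp
  calc _ = 4 ^ (N + r) * (ENNReal.ofReal (‖T‖ / 4) ^ N * volume S) := by
        rw [hvol, ← h4]; ring
    _ = 4 ^ (N + r) * ∫⁻ _ in S, ENNReal.ofReal (‖T‖ / 4) ^ N := by rw [setLIntegral_const]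
    _ ≤ 4 ^ (N + r) * ∫⁻ v in S, ‖T v‖ₑ ^ N := by
        gcongr 1
        exact setLIntegral_mono' Metric.isClosed_closedBall.measurableSet hlow
    _ ≤ _ := by gcongr

lemma integrable_exp_sum_signLaw {ι : Type*} [Fintype ι] (a : ι → ℝ) :
    Integrable (fun x : ι → ℝ => Real.exp (∑ e, a e * x e)) (Measure.pi fun _ => signLaw) := by
  simp_rw [Real.exp_sum]
  refine Integrable.fintype_prod (f := fun e y => Real.exp (a e * y)) (μ := fun _ => signLaw)
    fun e => ?_
  refine Integrable.of_bound (by fun_prop) (Real.exp |a e|) ?_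
  filter_upwards [abs_le_one_signLaw] with y hy
  rw [Real.norm_of_nonneg (Real.exp_pos _).le, Real.exp_le_exp]
  refine (le_abs_self _).trans ?_
  rw [abs_mul]
  exact mul_le_of_le_one_right (abs_nonneg _) hy

lemma integral_exp_sum_signLaw_le {ι : Type*} [Fintype ι] (a : ι → ℝ) :
    ∫ x, Real.exp (∑ e, a e * x e) ∂(Measure.pi fun _ : ι => signLaw) ≤
      Real.exp ((∑ e, a e ^ 2) / 2) := by
  simp_rw [Real.exp_sum]
  rw [integral_fintype_prod_eq_prod (fun e y => Real.exp (a e * y)) (μ := fun _ => signLaw),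
    Finset.sum_div, Real.exp_sum]
  refine Finset.prod_le_prod (fun e _ => integral_nonneg fun y => (Real.exp_pos _).le)
    fun e _ => ?_
  rw [integral_signLaw]
  have := Real.cosh_le_exp_half_sq (a e)
  rw [Real.cosh_eq] at this
  simpa using this

/-- Khintchine's inequality for even moments. -/
lemma lintegral_signLaw_pow_le {ι : Type*} [Fintype ι] (c : ι → ℝ) (hc : ∑ e, c e ^ 2 ≤ 1) {k : ℕ}
    (hk : 0 < k) :
    ∫⁻ x, ‖∑ e, c e * x e‖ₑ ^ (2 * k) ∂(Measure.pi fun _ : ι => signLaw) ≤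
      ENNReal.ofReal (2 * (2 * Real.exp 1 * k) ^ k) := by
  have hk' : (0 : ℝ) < k := by exact_mod_cast hk
  -- This `t` minimizes `t ^ (-2k) * exp (t ^ 2 / 2)`, the bound obtained from `|t y| ^ (2k) ≤ (2k)!
  -- * exp |t y|` and the subgaussian estimate.
  set t := √(2 * k) with ht
  have ht2 : t ^ 2 = 2 * k := Real.sq_sqrt (by positivity)
  have ht0 : 0 < t := by positivity
  have hpt : ∀ y : ℝ, |y| ^ (2 * k) ≤
      (2 * k : ℝ) ^ k * (Real.exp (t * y) + Real.exp (-(t * y))) := fun y => by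
    have h1 := Real.pow_div_factorial_le_exp (t * |y|) (by positivity) (2 * k)
    have h2 : Real.exp (t * |y|) ≤ Real.exp (t * y) + Real.exp (-(t * y)) := by
      rcases abs_cases y with ⟨h, -⟩ | ⟨h, -⟩ <;> rw [h]
      · linarith [Real.exp_pos (-(t * y))]
      · rw [mul_neg]; linarith [Real.exp_pos (t * y)]
    have h3 : ((2 * k).factorial : ℝ) ≤ (2 * k : ℝ) ^ (2 * k) := by
      exact_mod_cast Nat.factorial_le_pow (2 * k)
    rw [div_le_iff₀ (by positivity), mul_pow, pow_mul, ht2] at h1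
    have h4 : (2 * k : ℝ) ^ k * |y| ^ (2 * k) ≤
        (2 * k : ℝ) ^ k * ((2 * k : ℝ) ^ k * (Real.exp (t * y) + Real.exp (-(t * y)))) := by
      calc _ ≤ _ := h1
        _ ≤ (Real.exp (t * y) + Real.exp (-(t * y))) * (2 * k : ℝ) ^ (2 * k) := by gcongr
        _ = _ := by rw [two_mul k, pow_add]; ring
    exact le_of_mul_le_mul_left h4 (by positivity)
  have hintegr : ∀ b : ℝ, Integrable (fun x : ι → ℝ => Real.exp (b * ∑ e, c e * x e))
      (Measure.pi fun _ => signLaw) := fun b => by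
    simp_rw [Finset.mul_sum, ← mul_assoc]
    exact integrable_exp_sum_signLaw fun e => b * c e
  have hbd : ∀ b : ℝ, b ^ 2 = 2 * k →
      ∫ x, Real.exp (b * ∑ e, c e * x e) ∂(Measure.pi fun _ : ι => signLaw) ≤ Real.exp 1 ^ k :=
    fun b hb => by
      simp_rw [Finset.mul_sum, ← mul_assoc]
      refine (integral_exp_sum_signLaw_le fun e => b * c e).trans ?_
      rw [← Real.exp_nat_mul, Real.exp_le_exp]
      simp_rw [mul_pow, ← Finset.mul_sum, hb]
      nlinarith
  calc _ ≤ ∫⁻ x, ENNReal.ofReal ((2 * k : ℝ) ^ k * (Real.exp (t * ∑ e, c e * x e) +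
        Real.exp (-t * ∑ e, c e * x e))) ∂(Measure.pi fun _ : ι => signLaw) := by
        refine lintegral_mono fun x => ?_
        rw [← ofReal_norm, ← ENNReal.ofReal_pow (norm_nonneg _), neg_mul]
        exact ENNReal.ofReal_le_ofReal (hpt _)
    _ = ENNReal.ofReal (∫ x, (2 * k : ℝ) ^ k * (Real.exp (t * ∑ e, c e * x e) +
        Real.exp (-t * ∑ e, c e * x e)) ∂(Measure.pi fun _ : ι => signLaw)) := by
        rw [ofReal_integral_eq_lintegral_ofReal]
        · exact ((hintegr t).add (hintegr (-t))).const_mul _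
        · exact Eventually.of_forall fun x => by positivity
    _ ≤ _ := by
        refine ENNReal.ofReal_le_ofReal ?_
        rw [integral_const_mul, integral_add (hintegr t) (hintegr (-t))]
        calc _ ≤ (2 * k : ℝ) ^ k * (Real.exp 1 ^ k + Real.exp 1 ^ k) := by
              gcongr
              · exact hbd t ht2
              · exact hbd (-t) (by rw [neg_sq, ht2])
          _ = _ := by
              rw [show 2 * Real.exp 1 * (k : ℝ) = 2 * k * Real.exp 1 by ring, mul_pow _ (Real.exp 1)]
              ring

/-- The bilinear form of the matrix with entries `x`. -/
def entryForm {r : ℕ} (x : Fin r × Fin r → ℝ) (v u : EuclideanSpace ℝ (Fin r)) : ℝ :=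
  ∑ e : Fin r × Fin r, u e.1 * v e.2 * x e

lemma inner_toEuclideanCLM_entryMatrix {r : ℕ} (x : Fin r × Fin r → ℝ)
    (v u : EuclideanSpace ℝ (Fin r)) :
    inner ℝ (Matrix.toEuclideanCLM (n := Fin r) (𝕜 := ℝ) (entryMatrix x) v) u =
      entryForm x v u := by
  rw [PiLp.inner_apply, entryForm, Fintype.sum_prod_type]
  refine Finset.sum_congr rfl fun i _ => ?_
  rw [toEuclideanCLM_apply_coord]
  simp only [entryMatrix_apply, RCLike.inner_apply, conj_trivial, Finset.mul_sum]
  exact Finset.sum_congr rfl fun j _ => by ring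

lemma measurable_entryForm {r : ℕ} :
    Measurable fun z : ((Fin r × Fin r → ℝ) × EuclideanSpace ℝ (Fin r)) ×
      EuclideanSpace ℝ (Fin r) => entryForm z.1.1 z.1.2 z.2 := by
  have : Continuous fun z : ((Fin r × Fin r → ℝ) × EuclideanSpace ℝ (Fin r)) ×
      EuclideanSpace ℝ (Fin r) => entryForm z.1.1 z.1.2 z.2 := by
    unfold entryForm; fun_prop
  exact this.measurable

lemma lintegral_entryForm_signLaw_le {r k : ℕ} (hk : 0 < k) {v u : EuclideanSpace ℝ (Fin r)}
    (hv : ‖v‖ ≤ 1) (hu : ‖u‖ ≤ 1) :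
    ∫⁻ x, ‖entryForm x v u‖ₑ ^ (2 * k) ∂(Measure.pi fun _ : Fin r × Fin r => signLaw) ≤
      ENNReal.ofReal (2 * (2 * Real.exp 1 * k) ^ k) := by
  refine lintegral_signLaw_pow_le (fun e : Fin r × Fin r => u e.1 * v e.2) ?_ hk
  rw [Fintype.sum_prod_type]
  simp_rw [mul_pow, ← Finset.mul_sum, ← Finset.sum_mul]
  rw [← EuclideanSpace.real_norm_sq_eq, ← EuclideanSpace.real_norm_sq_eq]
  exact mul_le_one₀ (pow_le_one₀ (norm_nonneg _) hu) (by positivity)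
    (pow_le_one₀ (norm_nonneg _) hv)

lemma lintegral_ball_entryForm_signLaw_le {r k : ℕ} (hk : 0 < k) :
    ∫⁻ x, (∫⁻ v in Metric.closedBall (0 : EuclideanSpace ℝ (Fin r)) 1,
      ∫⁻ u in Metric.closedBall (0 : EuclideanSpace ℝ (Fin r)) 1, ‖entryForm x v u‖ₑ ^ (2 * k))
      ∂(Measure.pi fun _ : Fin r × Fin r => signLaw) ≤
    volume (Metric.closedBall (0 : EuclideanSpace ℝ (Fin r)) 1) *
      volume (Metric.closedBall (0 : EuclideanSpace ℝ (Fin r)) 1) *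
      ENNReal.ofReal (2 * (2 * Real.exp 1 * k) ^ k) := by
  have hmeas : Measurable fun z : ((Fin r × Fin r → ℝ) × EuclideanSpace ℝ (Fin r)) ×
      EuclideanSpace ℝ (Fin r) => ‖entryForm z.1.1 z.1.2 z.2‖ₑ ^ (2 * k) :=
    measurable_entryForm.enorm.pow_const _
  rw [lintegral_lintegral_swap (Measurable.lintegral_prod_right' hmeas).aemeasurable]
  have hin : ∀ v ∈ Metric.closedBall (0 : EuclideanSpace ℝ (Fin r)) 1,
      ∫⁻ x, (∫⁻ u in Metric.closedBall (0 : EuclideanSpace ℝ (Fin r)) 1,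
        ‖entryForm x v u‖ₑ ^ (2 * k)) ∂(Measure.pi fun _ : Fin r × Fin r => signLaw) ≤
      volume (Metric.closedBall (0 : EuclideanSpace ℝ (Fin r)) 1) *
        ENNReal.ofReal (2 * (2 * Real.exp 1 * k) ^ k) := fun v hv => by
    have hv' : Measurable fun z : (Fin r × Fin r → ℝ) × EuclideanSpace ℝ (Fin r) =>
        ((z.1, v), z.2) := by fun_prop
    rw [lintegral_lintegral_swap (f := fun x u => ‖entryForm x v u‖ₑ ^ (2 * k))
      (hmeas.comp hv').aemeasurable]
    refine (setLIntegral_mono' Metric.isClosed_closedBall.measurableSet fun u hu =>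
      lintegral_entryForm_signLaw_le hk (mem_closedBall_zero_iff.mp hv)
        (mem_closedBall_zero_iff.mp hu)).trans_eq ?_
    rw [setLIntegral_const, mul_comm]
  refine (setLIntegral_mono' Metric.isClosed_closedBall.measurableSet hin).trans_eq ?_
  rw [setLIntegral_const]; ring

/-- The average over the ball replaces a net argument. It is used twice, for `T` and for the
functional `⟨T v, ·⟩`, and bounds `‖T‖ ^ (2k)` by the mean of `|⟨T v, u⟩| ^ (2k)` over `v` and `u`.
After Tonelli, Khintchine's inequality applies for fixed `v` and `u` with coefficients `u i * v j`.
The loss is exponential in `k + r`, hence harmless for `r` of order `k`. -/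
lemma lintegral_specNorm_signLaw_le {r k : ℕ} (hk : 0 < k) :
    ∫⁻ x, ENNReal.ofReal (specNorm (entryMatrix x)) ^ (2 * k)
      ∂(Measure.pi fun _ : Fin r × Fin r => signLaw) ≤
    4 ^ (2 * k + r) * 4 ^ (2 * k + r) * ENNReal.ofReal (2 * (2 * Real.exp 1 * k) ^ k) := by
  have hV0 : volume (Metric.closedBall (0 : EuclideanSpace ℝ (Fin r)) 1) ≠ 0 :=
    (Metric.measure_closedBall_pos _ _ one_pos).ne'
  have hVtop : volume (Metric.closedBall (0 : EuclideanSpace ℝ (Fin r)) 1) ≠ ∞ :=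
    measure_closedBall_lt_top.ne
  have hI := lintegral_ball_entryForm_signLaw_le (r := r) hk
  set B := Metric.closedBall (0 : EuclideanSpace ℝ (Fin r)) 1
  set V := volume B
  set c : ℝ≥0∞ := 4 ^ (2 * k + r) with hc
  have hctop : c ≠ ∞ := by simp [hc]
  have hpt : ∀ x : Fin r × Fin r → ℝ,
      V * V * ENNReal.ofReal (specNorm (entryMatrix x)) ^ (2 * k) ≤
      c * c * ∫⁻ v in B, ∫⁻ u in B, ‖entryForm x v u‖ₑ ^ (2 * k) := fun x => by
    set T := Matrix.toEuclideanCLM (n := Fin r) (𝕜 := ℝ) (entryMatrix x) with hT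
    have h1 := volume_mul_enorm_pow_le T (2 * k)
    have h2 : ∀ v, V * ‖T v‖ₑ ^ (2 * k) ≤ c * ∫⁻ u in B, ‖entryForm x v u‖ₑ ^ (2 * k) := fun v => by
      have h := volume_mul_enorm_pow_le (innerSL ℝ (T v)) (2 * k)
      rw [← ofReal_norm, innerSL_apply_norm, ofReal_norm] at h
      refine h.trans_eq ?_
      simp_rw [innerSL_apply_apply, hT, inner_toEuclideanCLM_entryMatrix]
      rfl
    have h3 : ENNReal.ofReal (specNorm (entryMatrix x)) = ‖T‖ₑ := ofReal_norm _
    rw [h3]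
    calc V * V * ‖T‖ₑ ^ (2 * k) = V * (V * ‖T‖ₑ ^ (2 * k)) := mul_assoc _ _ _
      _ ≤ V * (c * ∫⁻ v in B, ‖T v‖ₑ ^ (2 * k)) := by gcongr
      _ = c * ∫⁻ v in B, V * ‖T v‖ₑ ^ (2 * k) := by
          rw [lintegral_const_mul' _ _ hVtop]; ring
      _ ≤ c * ∫⁻ v in B, c * ∫⁻ u in B, ‖entryForm x v u‖ₑ ^ (2 * k) := by
          gcongr 1
          exact lintegral_mono h2
      _ = _ := by rw [lintegral_const_mul' _ _ hctop, mul_assoc]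
  refine (ENNReal.mul_le_mul_iff_right (mul_ne_zero hV0 hV0)
    (ENNReal.mul_ne_top hVtop hVtop)).mp ?_
  rw [← lintegral_const_mul' _ _ (ENNReal.mul_ne_top hVtop hVtop)]
  refine (lintegral_mono hpt).trans ?_
  rw [lintegral_const_mul' _ _ (ENNReal.mul_ne_top hctop hctop)]
  refine (mul_le_mul_right hI (c * c)).trans_eq ?_
  ring

/-! ### The norm of a matrix with bounded symmetric entries -/

/-- High moments of the norm of a matrix with independent symmetric entries bounded by one and of
variance at most `s`. -/
lemma lintegral_specNorm_pow_le_of_bounded {n l : ℕ} {ν : Measure ℝ} [IsProbabilityMeasure ν]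
    (hsymm : ν.map (fun y => -y) = ν) (hb : ∀ᵐ y ∂ν, |y| ≤ 1) {s : ℝ} (hs0 : 0 < s) (hs1 : s ≤ 1)
    (hv : ∫ y, y ^ 2 ∂ν ≤ s) {k : ℕ} (hk : k = 2 ^ (l + 1)) (hn : n * s ≤ k) :
    ∫⁻ x, ENNReal.ofReal (specNorm (entryMatrix x)) ^ (2 * k)
      ∂(Measure.pi fun _ : Fin n × Fin n => ν) ≤
    ENNReal.ofReal (s⁻¹ * (4 * k) * (2 ^ 17 * Real.exp 1 * k) ^ k) := by
  obtain ⟨j, hj⟩ : ∃ j, k = j + 1 := Nat.exists_eq_succ_of_ne_zero (by rw [hk]; positivity)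
  have htr : ∀ {N : ℕ} (x : Fin N × Fin N → ℝ), specNorm (entryMatrix x) ^ (2 * k) ≤
      ((entryMatrix x * (entryMatrix x).transpose) ^ (j + 1)).trace := fun x => by
    rw [← hj, hk]
    exact specNorm_pow_le_trace _ l
  have htr0 : ∀ {N : ℕ} (x : Fin N × Fin N → ℝ),
      0 ≤ ((entryMatrix x * (entryMatrix x).transpose) ^ (j + 1)).trace := fun x =>
    (pow_nonneg (specNorm_nonneg _) _).trans (htr x)
  -- Since `n * s ≤ k`, size `2 * k` is admissible; being proportional to the order of the moment,
  -- it turns the loss of the ball averages into a factor `C ^ k`.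
  have hcomp := integral_trace_pow_le_signLaw (n := n) (m := 2 * k) (k := j) hsymm hb hs0 hs1 hv
    (by rw [← hj]; push_cast; linarith)
  calc _ ≤ ∫⁻ x, ENNReal.ofReal ((entryMatrix x * (entryMatrix x).transpose) ^ (j + 1)).trace
        ∂(Measure.pi fun _ : Fin n × Fin n => ν) := by
        refine lintegral_mono fun x => ?_
        rw [← ENNReal.ofReal_pow (specNorm_nonneg _)]
        exact ENNReal.ofReal_le_ofReal (htr x)
    _ = ENNReal.ofReal (∫ x, ((entryMatrix x * (entryMatrix x).transpose) ^ (j + 1)).trace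
        ∂(Measure.pi fun _ : Fin n × Fin n => ν)) := by
        rw [ofReal_integral_eq_lintegral_ofReal (integrable_trace_pow hb)]
        exact Eventually.of_forall htr0
    _ ≤ ENNReal.ofReal s⁻¹ * ∫⁻ x, ENNReal.ofReal
        ((entryMatrix x * (entryMatrix x).transpose) ^ (j + 1)).trace
        ∂(Measure.pi fun _ : Fin (2 * k) × Fin (2 * k) => signLaw) := by
        rw [← ofReal_integral_eq_lintegral_ofReal (integrable_trace_pow abs_le_one_signLaw)
          (Eventually.of_forall htr0), ← ENNReal.ofReal_mul (by positivity)]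
        exact ENNReal.ofReal_le_ofReal hcomp
    _ ≤ ENNReal.ofReal s⁻¹ * ∫⁻ x, ENNReal.ofReal (2 * k) *
        ENNReal.ofReal (specNorm (entryMatrix x)) ^ (2 * k)
        ∂(Measure.pi fun _ : Fin (2 * k) × Fin (2 * k) => signLaw) := by
        gcongr with x
        rw [← ENNReal.ofReal_pow (specNorm_nonneg _), ← ENNReal.ofReal_mul (by positivity)]
        refine ENNReal.ofReal_le_ofReal ((trace_le_mul_specNorm_pow _ j.succ_pos).trans_eq ?_)
        rw [Nat.succ_eq_add_one, ← hj]
        push_cast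
        rfl
    _ ≤ ENNReal.ofReal s⁻¹ * (ENNReal.ofReal (2 * k) * (4 ^ (2 * k + 2 * k) * 4 ^ (2 * k + 2 * k) *
        ENNReal.ofReal (2 * (2 * Real.exp 1 * k) ^ k))) := by
        rw [lintegral_const_mul' _ _ ENNReal.ofReal_ne_top]
        gcongr
        exact lintegral_specNorm_signLaw_le (by omega)
    _ = _ := by
        have h4 : (4 : ℝ≥0∞) = ENNReal.ofReal 4 := by simp
        rw [h4, ← ENNReal.ofReal_pow (by positivity), ← ENNReal.ofReal_mul (by positivity),
          ← ENNReal.ofReal_mul (by positivity), ← ENNReal.ofReal_mul (by positivity),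
          ← ENNReal.ofReal_mul (by positivity)]
        congr 1
        have h5 : (4 : ℝ) ^ (2 * k + 2 * k) = (2 ^ 8) ^ k := by
          rw [← pow_mul, show (4 : ℝ) = 2 ^ 2 by norm_num, ← pow_mul]; congr 1; ring
        rw [h5, show (2 : ℝ) ^ 17 * Real.exp 1 * k = 2 ^ 8 * 2 ^ 8 * (2 * Real.exp 1 * k) by ring,
          mul_pow (2 ^ 8 * 2 ^ 8) (2 * Real.exp 1 * (k : ℝ)), mul_pow (2 ^ 8 : ℝ) (2 ^ 8)]
        ring

/-! ### The contribution of large entries -/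

/-- Some row or column contains more than `d` entries of absolute value larger than `τ`. -/
def crowdedSet (n d : ℕ) (τ : ℝ) : Set (Fin n × Fin n → ℝ) :=
  ⋃ i : Fin n, ⋃ T ∈ (Finset.univ : Finset (Fin n)).powersetCard (d + 1),
    ({x | ∀ j ∈ T, τ < |x (i, j)|} ∪ {x | ∀ j ∈ T, τ < |x (j, i)|})

lemma measurableSet_crowdedSet (n d : ℕ) (τ : ℝ) : MeasurableSet (crowdedSet n d τ) := by
  have h : ∀ e : Fin n × Fin n, MeasurableSet {x : Fin n × Fin n → ℝ | τ < |x e|} := fun e =>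
    measurableSet_lt measurable_const (measurable_pi_apply e).abs
  refine MeasurableSet.iUnion fun i => Finset.measurableSet_biUnion _ fun T _ =>
    MeasurableSet.union ?_ ?_ <;>
  · simp only [Set.ofPred_forall]
    exact Finset.measurableSet_biInter _ fun j _ => h _

lemma measure_forall_lt_abs {ι : Type*} [Fintype ι] {ν : Measure ℝ} [IsProbabilityMeasure ν] {τ : ℝ}
    (S : Finset ι) :
    (Measure.pi fun _ : ι => ν) {x | ∀ e ∈ S, τ < |x e|} = ν {y | τ < |y|} ^ S.card := by
  classical
  have h : {x : ι → ℝ | ∀ e ∈ S, τ < |x e|} =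
      Set.pi Set.univ fun e => if e ∈ S then {y : ℝ | τ < |y|} else Set.univ := by
    ext x
    simp only [Set.mem_ofPred_eq, Set.mem_pi, Set.mem_univ, true_implies]
    refine forall_congr' fun e => ?_
    split_ifs with he <;> simp [he]
  rw [h, Measure.pi_pi, ← Finset.prod_const, ← Finset.prod_subset (Finset.subset_univ S)]
  · exact Finset.prod_congr rfl fun e he => by rw [if_pos he]
  · intro e _ he
    rw [if_neg he, measure_univ]

/-- Union bound over the `2 n` rows and columns and the at most `n ^ (d + 1)` sets of positions,
with independence within each set. -/
lemma measure_crowdedSet_le (n d : ℕ) (τ : ℝ) {ν : Measure ℝ} [IsProbabilityMeasure ν] :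
    (Measure.pi fun _ : Fin n × Fin n => ν) (crowdedSet n d τ) ≤
      2 * n * (n * ν {y | τ < |y|}) ^ (d + 1) := by
  have hrow : ∀ (i : Fin n) (T : Finset (Fin n)), (Measure.pi fun _ : Fin n × Fin n => ν)
      {x | ∀ j ∈ T, τ < |x (i, j)|} = ν {y | τ < |y|} ^ T.card := fun i T => by
    rw [← Finset.card_map (Function.Embedding.sectR i (Fin n)), ← measure_forall_lt_abs]
    simp
  have hcol : ∀ (i : Fin n) (T : Finset (Fin n)), (Measure.pi fun _ : Fin n × Fin n => ν)
      {x | ∀ j ∈ T, τ < |x (j, i)|} = ν {y | τ < |y|} ^ T.card := fun i T => by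
    rw [← Finset.card_map (Function.Embedding.sectL (Fin n) i), ← measure_forall_lt_abs]
    simp
  refine (measure_iUnion_fintype_le _ _).trans ?_
  have : ∀ i : Fin n, (Measure.pi fun _ : Fin n × Fin n => ν)
      (⋃ T ∈ (Finset.univ : Finset (Fin n)).powersetCard (d + 1),
        ({x | ∀ j ∈ T, τ < |x (i, j)|} ∪ {x | ∀ j ∈ T, τ < |x (j, i)|})) ≤
      n ^ (d + 1) * (2 * ν {y | τ < |y|} ^ (d + 1)) := fun i => by
    refine (measure_biUnion_finset_le _ _).trans ?_
    calc _ ≤ ∑ _T ∈ (Finset.univ : Finset (Fin n)).powersetCard (d + 1),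
          2 * ν {y | τ < |y|} ^ (d + 1) := by
          refine Finset.sum_le_sum fun T hT => (measure_union_le _ _).trans_eq ?_
          rw [hrow, hcol, (Finset.mem_powersetCard.mp hT).2, two_mul]
      _ = (n.choose (d + 1) : ℝ≥0∞) * (2 * ν {y | τ < |y|} ^ (d + 1)) := by
          rw [Finset.sum_const, Finset.card_powersetCard, Finset.card_univ, Fintype.card_fin,
            nsmul_eq_mul]
      _ ≤ _ := by
          gcongr
          exact_mod_cast Nat.choose_le_pow n (d + 1)
  refine (Finset.sum_le_sum fun i _ => this i).trans_eq ?_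
  simp only [Finset.sum_const, Finset.card_univ, Fintype.card_fin, nsmul_eq_mul, mul_pow]
  ring

/-- The part of an entry that exceeds `τ` in absolute value. -/
def largePart (τ y : ℝ) : ℝ := if |y| ≤ τ then 0 else y

lemma measurable_largePart (τ : ℝ) : Measurable (largePart τ) :=
  Measurable.ite (measurableSet_le measurable_id.abs measurable_const) measurable_const
    measurable_id

lemma abs_largePart_le (τ y : ℝ) : |largePart τ y| ≤ |y| := by
  unfold largePart; split_ifs <;> simp

lemma lt_abs_of_largePart_ne_zero {τ y : ℝ} (h : largePart τ y ≠ 0) : τ < |y| := by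
  by_contra h'
  exact h (if_pos (not_lt.mp h'))

lemma abs_le_sum_rpow {ι : Type*} [Fintype ι] {q : ℝ} (hq : 0 < q) (x : ι → ℝ) (e : ι) :
    |x e| ≤ (∑ f, |x f| ^ q) ^ q⁻¹ := by
  calc |x e| = (|x e| ^ q) ^ q⁻¹ := (Real.rpow_rpow_inv (abs_nonneg _) hq.ne').symm
    _ ≤ _ := by
        gcongr
        exact Finset.single_le_sum (f := fun f => |x f| ^ q) (fun f _ => by positivity)
          (Finset.mem_univ e)

lemma specNorm_largePart_le {n : ℕ} {q : ℝ} (hq : 0 < q) (τ : ℝ) (x : Fin n × Fin n → ℝ) :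
    specNorm (entryMatrix fun e => largePart τ (x e)) ≤ (∑ e, |x e| ^ q) ^ q⁻¹ * n := by
  refine specNorm_le_mul_of_card_le (by positivity) (fun i j => ?_) (fun i => ?_) fun j => ?_
  · exact (abs_largePart_le _ _).trans (abs_le_sum_rpow hq x _)
  · exact (Finset.card_le_univ _).trans_eq (Fintype.card_fin n)
  · exact (Finset.card_le_univ _).trans_eq (Fintype.card_fin n)

lemma specNorm_largePart_le_of_notMem {n d : ℕ} {q : ℝ} (hq : 0 < q) {τ : ℝ}
    {x : Fin n × Fin n → ℝ} (hx : x ∉ crowdedSet n d τ) :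
    specNorm (entryMatrix fun e => largePart τ (x e)) ≤ (∑ e, |x e| ^ q) ^ q⁻¹ * d := by
  simp only [crowdedSet, Set.mem_iUnion, not_exists, Set.mem_union, not_or] at hx
  refine specNorm_le_mul_of_card_le (by positivity) (fun i j => ?_) (fun i => ?_) fun j => ?_
  · exact (abs_largePart_le _ _).trans (abs_le_sum_rpow hq x _)
  · by_contra! h
    obtain ⟨T, hT, hc⟩ := Finset.exists_subset_card_eq (Nat.succ_le_of_lt h)
    refine (hx i T (Finset.mem_powersetCard.mpr ⟨Finset.subset_univ _, hc⟩)).1 fun j hj => ?_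
    exact lt_abs_of_largePart_ne_zero (Finset.mem_filter.mp (hT hj)).2
  · by_contra! h
    obtain ⟨T, hT, hc⟩ := Finset.exists_subset_card_eq (Nat.succ_le_of_lt h)
    refine (hx j T (Finset.mem_powersetCard.mpr ⟨Finset.subset_univ _, hc⟩)).2 fun i hi => ?_
    exact lt_abs_of_largePart_ne_zero (Finset.mem_filter.mp (hT hi)).2

lemma lintegral_sum_rpow {ι : Type*} [Fintype ι] {ν : Measure ℝ} [IsProbabilityMeasure ν] (q : ℝ) :
    ∫⁻ x, ∑ e, ‖x e‖ₑ ^ q ∂(Measure.pi fun _ : ι => ν) =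
      Fintype.card ι * ∫⁻ y, ‖y‖ₑ ^ q ∂ν := by
  rw [lintegral_finsetSum _ fun e _ => by fun_prop]
  have : ∀ e : ι, ∫⁻ x, ‖x e‖ₑ ^ q ∂(Measure.pi fun _ : ι => ν) = ∫⁻ y, ‖y‖ₑ ^ q ∂ν := fun e =>
    (measurePreserving_eval (fun _ : ι => ν) e).lintegral_comp
      (f := fun y => ‖y‖ₑ ^ q) (by fun_prop)
  simp [this]

/-- The maximal entry is bounded by the `ℓ^q` norm of all entries, whose `q`-th power has mean `n²
E|y|^q`. The norm is at most `d` times it off the crowded set and `n` times it on that set. The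
second case is split by Hölder with weights `r / q` and `1 - r / q`, which is where `r < q` matters.
-/
lemma lintegral_specNorm_largePart_le {n d : ℕ} {ν : Measure ℝ} [IsProbabilityMeasure ν]
    {τ r q : ℝ} (hr : 0 < r) (hrq : r < q) :
    ∫⁻ x, ENNReal.ofReal (specNorm (entryMatrix fun e => largePart τ (x e))) ^ r
      ∂(Measure.pi fun _ : Fin n × Fin n => ν) ≤
    (n * n * ∫⁻ y, ‖y‖ₑ ^ q ∂ν) ^ (r / q) *
      (d ^ r + n ^ r * (2 * n * (n * ν {y | τ < |y|}) ^ (d + 1)) ^ (1 - r / q)) := by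
  have hq : 0 < q := hr.trans hrq
  have hrq1 : r / q < 1 := (div_lt_one hq).mpr hrq
  set μ := Measure.pi fun _ : Fin n × Fin n => ν
  set U := crowdedSet n d τ
  set f : (Fin n × Fin n → ℝ) → ℝ≥0∞ := fun x => ∑ e, ‖x e‖ₑ ^ q with hf
  set g : (Fin n × Fin n → ℝ) → ℝ≥0∞ := U.indicator 1 with hg
  have hU : MeasurableSet U := measurableSet_crowdedSet n d τ
  have hfm : Measurable f := by simp only [hf]; fun_prop
  have hgm : Measurable g := measurable_one.indicator hU
  have hfx : ∀ (x : Fin n × Fin n → ℝ) (m : ℕ),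
      ENNReal.ofReal ((∑ e, |x e| ^ q) ^ q⁻¹ * m) ^ r = f x ^ (r / q) * (m : ℝ≥0∞) ^ r := fun x m => by
    rw [ENNReal.ofReal_mul (by positivity), ENNReal.mul_rpow_of_nonneg _ _ hr.le,
      ENNReal.ofReal_natCast, ← ENNReal.ofReal_rpow_of_nonneg (by positivity) (by positivity),
      ← ENNReal.rpow_mul, ENNReal.ofReal_sum_of_nonneg fun e _ => by positivity]
    congr 2
    · simp only [hf]
      refine Finset.sum_congr rfl fun e _ => ?_
      rw [← ENNReal.ofReal_rpow_of_nonneg (abs_nonneg _) hq.le, ← Real.norm_eq_abs, ofReal_norm]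
    · field_simp
  have hpt : ∀ x, ENNReal.ofReal (specNorm (entryMatrix fun e => largePart τ (x e))) ^ r ≤
      f x ^ (r / q) * (d : ℝ≥0∞) ^ r + (n : ℝ≥0∞) ^ r * (f x ^ (r / q) * g x ^ (1 - r / q)) :=
    fun x => by
      by_cases hx : x ∈ U
      · refine le_add_left ?_
        rw [hg, Set.indicator_of_mem hx, Pi.one_apply, ENNReal.one_rpow, mul_one, mul_comm, ← hfx]
        gcongr
        exact specNorm_largePart_le hq τ x
      · refine le_add_right ?_
        rw [← hfx]
        gcongr
        exact specNorm_largePart_le_of_notMem hq hx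
  have hfint : ∫⁻ x, f x ∂μ = n * n * ∫⁻ y, ‖y‖ₑ ^ q ∂ν := by
    rw [hf, lintegral_sum_rpow]; simp
  have h1 : ∫⁻ x, f x ^ (r / q) ∂μ ≤ (∫⁻ x, f x ∂μ) ^ (r / q) := by
    have h := ENNReal.lintegral_mul_norm_pow_le (μ := μ) hfm.aemeasurable
      (measurable_const (a := (1 : ℝ≥0∞))).aemeasurable (p := r / q) (q := 1 - r / q)
      (by positivity) (by linarith) (by ring)
    simpa using h
  have h2 : ∫⁻ x, f x ^ (r / q) * g x ^ (1 - r / q) ∂μ ≤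
      (∫⁻ x, f x ∂μ) ^ (r / q) * (μ U) ^ (1 - r / q) := by
    have h := ENNReal.lintegral_mul_norm_pow_le (μ := μ) hfm.aemeasurable
      hgm.aemeasurable (p := r / q) (q := 1 - r / q)
      (by positivity) (by linarith) (by ring)
    rwa [hg, lintegral_indicator_one hU] at h
  calc _ ≤ ∫⁻ x, (f x ^ (r / q) * (d : ℝ≥0∞) ^ r +
        (n : ℝ≥0∞) ^ r * (f x ^ (r / q) * g x ^ (1 - r / q))) ∂μ := lintegral_mono hpt
    _ = (∫⁻ x, f x ^ (r / q) ∂μ) * (d : ℝ≥0∞) ^ r +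
        (n : ℝ≥0∞) ^ r * ∫⁻ x, f x ^ (r / q) * g x ^ (1 - r / q) ∂μ := by
        rw [lintegral_add_left (by fun_prop), lintegral_mul_const _ (by fun_prop),
          lintegral_const_mul _ (by fun_prop)]
    _ ≤ (∫⁻ x, f x ∂μ) ^ (r / q) * (d : ℝ≥0∞) ^ r +
        (n : ℝ≥0∞) ^ r * ((∫⁻ x, f x ∂μ) ^ (r / q) *
          (2 * n * (n * ν {y | τ < |y|}) ^ (d + 1)) ^ (1 - r / q)) := by
        gcongr
        refine h2.trans ?_
        gcongr
        exact measure_crowdedSet_le n d τ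
    _ = _ := by rw [hfint]; ring

/-! ### Laws of the entries and symmetrization -/

/-- The law of `δ ξ` with `δ` Bernoulli and `ξ` of law `ρ`. -/
def entryLaw (p : ℝ) (ρ : Measure ℝ) : Measure ℝ :=
  ((berLaw p).prod ρ).map fun z => z.1 * z.2

/-- The law of the difference of two independent copies. -/
def symmLaw (μ : Measure ℝ) : Measure ℝ :=
  (μ.prod μ).map fun z => z.1 - z.2

lemma isProbabilityMeasure_berLaw {p : ℝ} (h0 : 0 ≤ p) (h1 : p ≤ 1) :
    IsProbabilityMeasure (berLaw p) :=
  ⟨by simp [berLaw, ← ENNReal.ofReal_add h0 (sub_nonneg.mpr h1)]⟩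

lemma isProbabilityMeasure_entryLaw {p : ℝ} (h0 : 0 ≤ p) (h1 : p ≤ 1) (ρ : Measure ℝ)
    [IsProbabilityMeasure ρ] : IsProbabilityMeasure (entryLaw p ρ) := by
  have := isProbabilityMeasure_berLaw h0 h1
  exact Measure.isProbabilityMeasure_map (by fun_prop)

instance (μ : Measure ℝ) [IsProbabilityMeasure μ] : IsProbabilityMeasure (symmLaw μ) :=
  Measure.isProbabilityMeasure_map (by fun_prop)

lemma map_prod_pi {ι : Type*} [Fintype ι] (μ ν : Measure ℝ) [IsProbabilityMeasure μ]
    [IsProbabilityMeasure ν] {f : ℝ × ℝ → ℝ} (hf : Measurable f) :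
    ((Measure.pi fun _ : ι => μ).prod (Measure.pi fun _ : ι => ν)).map
      (fun z e => f (z.1 e, z.2 e)) = Measure.pi fun _ : ι => (μ.prod ν).map f := by
  have h := (measurePreserving_arrowProdEquivProdArrow ℝ ℝ ι (fun _ => μ) (fun _ => ν)).symm
  have : ∀ _ : ι, IsProbabilityMeasure ((μ.prod ν).map f) := fun _ =>
    Measure.isProbabilityMeasure_map hf.aemeasurable
  rw [← Measure.pi_map_pi (μ := fun _ : ι => μ.prod ν) (f := fun _ => f)
    (fun _ => hf.aemeasurable), ← h.map_eq, Measure.map_map _ h.measurable]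
  · rfl
  · exact measurable_pi_lambda _ fun e => hf.comp (measurable_pi_apply e)

/-- This removes the abstract probability space: all estimates are then made on a product space that
depends only on `n`, `p` and `ρ`. -/
lemma IsSparseModel.map_eq_pi {Ω : Type*} [MeasurableSpace Ω] {P : Measure Ω}
    [IsProbabilityMeasure P] {n : ℕ} {p : ℝ} (h0 : 0 ≤ p) (h1 : p ≤ 1) {ρ : Measure ℝ}
    [IsProbabilityMeasure ρ] {δ ξ : Fin n → Fin n → Ω → ℝ} (h : IsSparseModel P n p ρ δ ξ) :
    P.map (fun ω (e : Fin n × Fin n) => δ e.1 e.2 ω * ξ e.1 e.2 ω) =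
      Measure.pi fun _ : Fin n × Fin n => entryLaw p ρ := by
  have := isProbabilityMeasure_berLaw h0 h1
  set F : (Fin n × Fin n) ⊕ (Fin n × Fin n) → Ω → ℝ :=
    Sum.elim (fun ij => δ ij.1 ij.2) (fun ij => ξ ij.1 ij.2) with hF
  have hFm : ∀ s, Measurable (F s) := by
    rintro (e | e)
    · exact h.measurable_delta _ _
    · exact h.measurable_xi _ _
  have hlaw : ∀ s, IsProbabilityMeasure (P.map (F s)) := fun s =>
    Measure.isProbabilityMeasure_map (hFm s).aemeasurable
  have hmap := h.indep.map_fun_eq_pi_map fun s => (hFm s).aemeasurable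
  have hsum := measurePreserving_sumPiEquivProdPi fun s => P.map (F s)
  have hl : (fun e => P.map (F (Sum.inl e))) = fun _ => berLaw p := by
    ext1 e; exact h.law_delta _ _
  have hr : (fun e => P.map (F (Sum.inr e))) = fun _ => ρ := by
    ext1 e; exact h.law_xi _ _
  have hpair : P.map (fun ω => ((fun e : Fin n × Fin n => δ e.1 e.2 ω),
      (fun e : Fin n × Fin n => ξ e.1 e.2 ω))) =
      (Measure.pi fun _ : Fin n × Fin n => berLaw p).prod
        (Measure.pi fun _ : Fin n × Fin n => ρ) := by
    have := hsum.map_eq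
    rw [hl, hr, ← hmap, Measure.map_map hsum.measurable (measurable_pi_lambda _ hFm)] at this
    exact this
  rw [entryLaw, ← map_prod_pi (berLaw p) ρ (by fun_prop), ← hpair, Measure.map_map]
  · rfl
  · exact measurable_pi_lambda _ fun e => by fun_prop
  · exact (measurable_pi_lambda _ fun e => h.measurable_delta _ _).prodMk
      (measurable_pi_lambda _ fun e => h.measurable_xi _ _)

lemma IsSparseModel.lintegral_specNorm_eq {Ω : Type*} [MeasurableSpace Ω] {P : Measure Ω}
    [IsProbabilityMeasure P] {n : ℕ} {p : ℝ} (h0 : 0 ≤ p) (h1 : p ≤ 1) {ρ : Measure ℝ}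
    [IsProbabilityMeasure ρ] {δ ξ : Fin n → Fin n → Ω → ℝ} (h : IsSparseModel P n p ρ δ ξ)
    {f : ℝ → ℝ≥0∞} (hf : Measurable f) :
    ∫⁻ ω, f (specNorm (sparseMatrix δ ξ ω)) ∂P =
      ∫⁻ x, f (specNorm (entryMatrix x)) ∂(Measure.pi fun _ : Fin n × Fin n => entryLaw p ρ) := by
  rw [← h.map_eq_pi h0 h1, lintegral_map (f := fun x => f (specNorm (entryMatrix x)))
    (hf.comp measurable_specNorm_entryMatrix)]
  · rfl
  · exact measurable_pi_lambda _ fun e => (h.measurable_delta _ _).mul (h.measurable_xi _ _)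

lemma lintegral_entryLaw {p : ℝ} (h0 : 0 ≤ p) (h1 : p ≤ 1) (ρ : Measure ℝ)
    [IsProbabilityMeasure ρ] {g : ℝ → ℝ≥0∞} (hg : Measurable g) :
    ∫⁻ y, g y ∂(entryLaw p ρ) =
      ENNReal.ofReal p * ∫⁻ y, g y ∂ρ + ENNReal.ofReal (1 - p) * g 0 := by
  have := isProbabilityMeasure_berLaw h0 h1
  have hg2 : Measurable fun z : ℝ × ℝ => g (z.1 * z.2) := by fun_prop
  rw [entryLaw, lintegral_map hg (by fun_prop), lintegral_prod _ hg2.aemeasurable, berLaw,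
    lintegral_add_measure, lintegral_smul_measure, lintegral_smul_measure,
    lintegral_dirac' _ hg2.lintegral_prod_right', lintegral_dirac' _ hg2.lintegral_prod_right']
  simp

lemma lintegral_rpow_le_rpow_lintegral {α : Type*} [MeasurableSpace α] {μ : Measure α}
    [IsProbabilityMeasure μ] {f : α → ℝ≥0∞} (hf : AEMeasurable f μ) {a : ℝ} (h0 : 0 ≤ a)
    (h1 : a ≤ 1) : ∫⁻ x, f x ^ a ∂μ ≤ (∫⁻ x, f x ∂μ) ^ a := by
  have h := ENNReal.lintegral_mul_norm_pow_le (μ := μ) hf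
    (measurable_const (a := (1 : ℝ≥0∞))).aemeasurable (p := a) (q := 1 - a)
    h0 (by linarith) (by ring)
  simpa using h

lemma rpow_lintegral_le_lintegral_rpow {α : Type*} [MeasurableSpace α] {μ : Measure α}
    [IsProbabilityMeasure μ] {f : α → ℝ≥0∞} (hf : AEMeasurable f μ) {a : ℝ} (h1 : 1 ≤ a) :
    (∫⁻ x, f x ∂μ) ^ a ≤ ∫⁻ x, f x ^ a ∂μ := by
  have h := lintegral_rpow_le_rpow_lintegral (hf.pow_const a) (a := a⁻¹) (by positivity)
    (inv_le_one_of_one_le₀ h1)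
  simp_rw [ENNReal.rpow_rpow_inv (by positivity : a ≠ 0)] at h
  calc _ ≤ ((∫⁻ x, f x ^ a ∂μ) ^ a⁻¹) ^ a := by gcongr
    _ = _ := ENNReal.rpow_inv_rpow (by positivity) _

/-- Averaging over the centered `y` recovers the matrix of `x` from that of `x - y`, and the norm of
a mean is at most the mean of the norm. -/
lemma ofReal_specNorm_le_lintegral_sub {n : ℕ} {μ : Measure ℝ} [IsProbabilityMeasure μ]
    (hi : Integrable (fun y : ℝ => y) μ) (h0 : ∫ y, y ∂μ = 0) (x : Fin n × Fin n → ℝ) :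
    ENNReal.ofReal (specNorm (entryMatrix x)) ≤
      ∫⁻ y, ENNReal.ofReal (specNorm (entryMatrix (x - y)))
        ∂(Measure.pi fun _ : Fin n × Fin n => μ) := by
  set Φ : (Fin n × Fin n → ℝ) →L[ℝ] EuclideanSpace ℝ (Fin n) →L[ℝ] EuclideanSpace ℝ (Fin n) :=
    LinearMap.toContinuousLinearMap
      { toFun := fun x => Matrix.toEuclideanCLM (n := Fin n) (𝕜 := ℝ) (entryMatrix x)
        map_add' := fun a b => by rw [← map_add]; rfl
        map_smul' := fun c a => by rw [← map_smul]; rfl } with hΦ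
  have hspec : ∀ z, ENNReal.ofReal (specNorm (entryMatrix z)) = ‖Φ z‖ₑ := fun z => ofReal_norm _
  have hev : ∀ e : Fin n × Fin n, Integrable (fun y : Fin n × Fin n → ℝ => y e)
      (Measure.pi fun _ : Fin n × Fin n => μ) := fun e =>
    (measurePreserving_eval (fun _ : Fin n × Fin n => μ) e).integrable_comp_of_integrable hi
  have hintegr : Integrable (fun y : Fin n × Fin n → ℝ => y)
      (Measure.pi fun _ : Fin n × Fin n => μ) := Integrable.of_eval hev
  have hzero : ∫ y, y ∂(Measure.pi fun _ : Fin n × Fin n => μ) = 0 := by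
    ext e
    rw [eval_integral hev]
    have hmp := measurePreserving_eval (fun _ : Fin n × Fin n => μ) e
    have := integral_map (μ := Measure.pi fun _ : Fin n × Fin n => μ) (f := fun y : ℝ => y)
      hmp.measurable.aemeasurable (by fun_prop)
    rw [hmp.map_eq, h0] at this
    exact this.symm
  have hx : Φ x = ∫ y, Φ (x - y) ∂(Measure.pi fun _ : Fin n × Fin n => μ) := by
    rw [Φ.integral_comp_comm (φ := fun y => x - y) ((integrable_const x).sub hintegr),
      integral_sub (integrable_const x) hintegr, hzero]
    simp
  simp_rw [hspec]
  rw [hx]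
  exact enorm_integral_le_lintegral_enorm _

/-- Symmetrization: replacing centered entries by differences of independent copies does not
decrease moments of the norm. -/
lemma lintegral_specNorm_rpow_le_symmLaw {n : ℕ} {μ : Measure ℝ} [IsProbabilityMeasure μ]
    (hi : Integrable (fun y : ℝ => y) μ) (h0 : ∫ y, y ∂μ = 0) {r : ℝ} (hr : 1 ≤ r) :
    ∫⁻ x, ENNReal.ofReal (specNorm (entryMatrix x)) ^ r ∂(Measure.pi fun _ : Fin n × Fin n => μ) ≤
    ∫⁻ x, ENNReal.ofReal (specNorm (entryMatrix x)) ^ r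
      ∂(Measure.pi fun _ : Fin n × Fin n => symmLaw μ) := by
  have hm : Measurable fun x : Fin n × Fin n → ℝ =>
      ENNReal.ofReal (specNorm (entryMatrix x)) ^ r :=
    measurable_specNorm_entryMatrix.ennreal_ofReal.pow_const r
  have hsub : Measurable fun z : (Fin n × Fin n → ℝ) × (Fin n × Fin n → ℝ) => z.1 - z.2 := by
    fun_prop
  have hmap : ((Measure.pi fun _ : Fin n × Fin n => μ).prod
      (Measure.pi fun _ : Fin n × Fin n => μ)).map (fun z => z.1 - z.2) =
      Measure.pi fun _ : Fin n × Fin n => (μ.prod μ).map fun z => z.1 - z.2 :=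
    map_prod_pi μ μ (f := fun z => z.1 - z.2) (measurable_fst.sub measurable_snd)
  rw [symmLaw, ← hmap, lintegral_map hm hsub,
    lintegral_prod (fun z => ENNReal.ofReal (specNorm (entryMatrix (z.1 - z.2))) ^ r)
      (hm.comp hsub).aemeasurable]
  refine lintegral_mono fun x => ?_
  have hsx : Measurable fun y : Fin n × Fin n → ℝ =>
      ENNReal.ofReal (specNorm (entryMatrix (x - y))) :=
    measurable_specNorm_entryMatrix.ennreal_ofReal.comp (by fun_prop)
  calc _ ≤ (∫⁻ y, ENNReal.ofReal (specNorm (entryMatrix (x - y)))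
        ∂(Measure.pi fun _ : Fin n × Fin n => μ)) ^ r := by
        gcongr
        exact ofReal_specNorm_le_lintegral_sub hi h0 x
    _ ≤ _ := rpow_lintegral_le_lintegral_rpow hsx.aemeasurable hr

lemma map_neg_symmLaw (μ : Measure ℝ) [IsProbabilityMeasure μ] :
    (symmLaw μ).map (fun y => -y) = symmLaw μ := by
  rw [symmLaw, Measure.map_map (by fun_prop) (by fun_prop)]
  conv_rhs => rw [← Measure.prod_swap, Measure.map_map (by fun_prop) (by fun_prop)]
  congr 1
  ext z
  simp

lemma lintegral_symmLaw_rpow_le {μ : Measure ℝ} [IsProbabilityMeasure μ] {q : ℝ} (hq : 1 ≤ q) :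
    ∫⁻ y, ‖y‖ₑ ^ q ∂(symmLaw μ) ≤ 2 ^ q * ∫⁻ y, ‖y‖ₑ ^ q ∂μ := by
  have hq0 : 0 ≤ q := by linarith
  rw [symmLaw, lintegral_map (by fun_prop) (by fun_prop)]
  have hpt : ∀ z : ℝ × ℝ, ‖z.1 - z.2‖ₑ ^ q ≤ 2 ^ (q - 1) * (‖z.1‖ₑ ^ q + ‖z.2‖ₑ ^ q) := fun z =>
    calc _ ≤ (‖z.1‖ₑ + ‖z.2‖ₑ) ^ q := by
          gcongr
          exact enorm_sub_le
      _ ≤ _ := ENNReal.rpow_add_le_mul_rpow_add_rpow _ _ hq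
  have h1 : ∫⁻ z : ℝ × ℝ, ‖z.1‖ₑ ^ q ∂(μ.prod μ) = ∫⁻ y, ‖y‖ₑ ^ q ∂μ :=
    measurePreserving_fst.lintegral_comp (f := fun y => ‖y‖ₑ ^ q) (by fun_prop)
  have h2 : ∫⁻ z : ℝ × ℝ, ‖z.2‖ₑ ^ q ∂(μ.prod μ) = ∫⁻ y, ‖y‖ₑ ^ q ∂μ :=
    measurePreserving_snd.lintegral_comp (f := fun y => ‖y‖ₑ ^ q) (by fun_prop)
  refine (lintegral_mono hpt).trans_eq ?_
  rw [lintegral_const_mul _ (by fun_prop), lintegral_add_left (by fun_prop), h1, h2, ← two_mul,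
    ← mul_assoc]
  congr 1
  conv_lhs => rw [← ENNReal.rpow_one 2, ← ENNReal.rpow_mul, one_mul]
  rw [← ENNReal.rpow_add _ _ (by norm_num) (by norm_num)]
  congr 1
  ring

/-! ### The contribution of small entries -/

/-- The part of an entry that does not exceed `τ` in absolute value, divided by `τ`. -/
def smallPart (τ y : ℝ) : ℝ := if |y| ≤ τ then y / τ else 0

lemma measurable_smallPart (τ : ℝ) : Measurable (smallPart τ) :=
  Measurable.ite (measurableSet_le measurable_id.abs measurable_const) (by fun_prop)
    measurable_const

lemma abs_smallPart_le_one {τ : ℝ} (hτ : 0 < τ) (y : ℝ) : |smallPart τ y| ≤ 1 := by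
  unfold smallPart
  split_ifs with h
  · rwa [abs_div, abs_of_pos hτ, div_le_one hτ]
  · simp

lemma smallPart_neg (τ y : ℝ) : smallPart τ (-y) = -smallPart τ y := by
  unfold smallPart
  rw [abs_neg]
  split_ifs <;> simp [neg_div]

lemma sq_smallPart_le (τ y : ℝ) : smallPart τ y ^ 2 ≤ y ^ 2 / τ ^ 2 := by
  unfold smallPart
  split_ifs
  · rw [div_pow]
  · rw [zero_pow two_ne_zero]; positivity

lemma smul_smallPart_add_largePart {n : ℕ} {τ : ℝ} (hτ : 0 < τ) (x : Fin n × Fin n → ℝ) :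
    entryMatrix x = τ • entryMatrix (fun e => smallPart τ (x e)) +
      entryMatrix fun e => largePart τ (x e) := by
  ext i j
  simp only [Matrix.add_apply, Matrix.smul_apply, entryMatrix_apply, smallPart, largePart,
    smul_eq_mul]
  split_ifs
  · field_simp; ring
  · simp

lemma integral_sq_map_smallPart_le {ν : Measure ℝ} [IsProbabilityMeasure ν] {τ p : ℝ}
    (hτ : 0 < τ) (hp : 0 < p) (hv : ∫⁻ y, ‖y‖ₑ ^ (2 : ℝ) ∂ν ≤ ENNReal.ofReal (4 * p)) :
    ∫ y, y ^ 2 ∂(ν.map (smallPart τ)) ≤ 4 * p / τ ^ 2 := by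
  have hpos : 0 ≤ 4 * p / τ ^ 2 := by positivity
  rw [integral_map (measurable_smallPart τ).aemeasurable (by fun_prop),
    integral_eq_lintegral_of_nonneg_ae (Eventually.of_forall fun y => sq_nonneg _)
      ((measurable_smallPart τ).pow_const 2).aestronglyMeasurable]
  refine ENNReal.toReal_le_of_le_ofReal hpos ?_
  calc _ ≤ ∫⁻ y, ENNReal.ofReal (τ ^ 2)⁻¹ * ‖y‖ₑ ^ (2 : ℝ) ∂ν := by
        refine lintegral_mono fun y => ?_
        rw [← ofReal_norm, ENNReal.ofReal_rpow_of_nonneg (norm_nonneg _) (by norm_num),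
          ← ENNReal.ofReal_mul (by positivity)]
        refine ENNReal.ofReal_le_ofReal ((sq_smallPart_le τ y).trans_eq ?_)
        rw [Real.rpow_two, Real.norm_eq_abs, sq_abs]
        field_simp
    _ ≤ ENNReal.ofReal (τ ^ 2)⁻¹ * ENNReal.ofReal (4 * p) := by
        rw [lintegral_const_mul' _ _ ENNReal.ofReal_ne_top]
        gcongr
    _ = _ := by
        rw [← ENNReal.ofReal_mul (by positivity)]
        congr 1
        field_simp

/-- In `L^(2k)` the rescaled matrix has norm of order `√k`, comparable to `√(n s)` with `s = 4 p / τ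
^ 2`, and `τ √(n s) = 2 √(n p)`. The prefactor `s⁻¹ * (4 * k) ≤ 8 * n` is absorbed into `2 ^ k` by
`hk3`, and Lyapunov's inequality lowers the exponent from `2 * k` to `r`. -/
lemma lintegral_specNorm_smallPart_le {n l k : ℕ} {ν : Measure ℝ} [IsProbabilityMeasure ν]
    (hsymm : ν.map (fun y => -y) = ν) {τ p r : ℝ} (hτ : 0 < τ) (hp : 0 < p) (hr : 0 < r)
    (hv : ∫⁻ y, ‖y‖ₑ ^ (2 : ℝ) ∂ν ≤ ENNReal.ofReal (4 * p)) (hs : 4 * p / τ ^ 2 ≤ 1)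
    (hk : k = 2 ^ (l + 1)) (hk1 : n * (4 * p / τ ^ 2) ≤ k) (hk2 : k ≤ 2 * (n * (4 * p / τ ^ 2)))
    (hk3 : 8 * n ≤ (2 : ℝ) ^ k) (hk4 : r ≤ 2 * k) :
    ∫⁻ x, ENNReal.ofReal (τ * specNorm (entryMatrix fun e => smallPart τ (x e))) ^ r
      ∂(Measure.pi fun _ : Fin n × Fin n => ν) ≤
    ENNReal.ofReal ((2 ^ 21 * Real.exp 1) ^ (r / 2) * √(n * p) ^ r) := by
  have hsm := measurable_smallPart τ
  have hprob : IsProbabilityMeasure (ν.map (smallPart τ)) :=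
    Measure.isProbabilityMeasure_map hsm.aemeasurable
  have hk0 : 0 < k := by rw [hk]; positivity
  have hk0' : (0 : ℝ) < k := by exact_mod_cast hk0
  set s := 4 * p / τ ^ 2 with hs_def
  have hs0 : 0 < s := by positivity
  have hsymm' : (ν.map (smallPart τ)).map (fun y => -y) = ν.map (smallPart τ) := by
    conv_rhs => rw [← hsymm]
    rw [Measure.map_map measurable_neg hsm, Measure.map_map hsm measurable_neg]
    congr 1
    ext y
    exact (smallPart_neg τ y).symm
  have hb : ∀ᵐ y ∂(ν.map (smallPart τ)), |y| ≤ 1 := by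
    refine (ae_map_iff hsm.aemeasurable (p := fun y => |y| ≤ 1)
      (measurableSet_le measurable_id.abs measurable_const)).mpr ?_
    exact Eventually.of_forall fun y => abs_smallPart_le_one hτ y
  have hmain := lintegral_specNorm_pow_le_of_bounded (n := n) (l := l) hsymm' hb hs0 hs
    (integral_sq_map_smallPart_le hτ hp hv) hk hk1
  have hmspec : Measurable fun x : Fin n × Fin n → ℝ => ENNReal.ofReal (specNorm (entryMatrix x)) :=
    measurable_specNorm_entryMatrix.ennreal_ofReal
  have hmpi : Measurable fun (x : Fin n × Fin n → ℝ) e => smallPart τ (x e) :=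
    measurable_pi_lambda _ fun e => hsm.comp (measurable_pi_apply e)
  rw [← Measure.pi_map_pi (f := fun _ : Fin n × Fin n => smallPart τ)
    (fun _ => hsm.aemeasurable), lintegral_map (hmspec.pow_const _) hmpi] at hmain
  set g : (Fin n × Fin n → ℝ) → ℝ≥0∞ := fun x =>
    ENNReal.ofReal (specNorm (entryMatrix fun e => smallPart τ (x e))) with hg
  have hgm : Measurable g := hmspec.comp hmpi
  have hτg : ∀ x : Fin n × Fin n → ℝ,
      ENNReal.ofReal (τ * specNorm (entryMatrix fun e => smallPart τ (x e))) =
      ENNReal.ofReal τ * g x := fun x => ENNReal.ofReal_mul hτ.le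
  simp_rw [hτg]
  have hhigh : ∫⁻ x, (ENNReal.ofReal τ * g x) ^ (2 * k) ∂(Measure.pi fun _ : Fin n × Fin n => ν) ≤
      ENNReal.ofReal ((2 ^ 21 * Real.exp 1 * (n * p)) ^ k) := by
    simp_rw [mul_pow]
    rw [lintegral_const_mul _ (hgm.pow_const _)]
    refine (mul_le_mul_right hmain _).trans ?_
    rw [← ENNReal.ofReal_pow hτ.le, ← ENNReal.ofReal_mul (by positivity)]
    refine ENNReal.ofReal_le_ofReal ?_
    have h1 : s⁻¹ * (4 * k) ≤ 8 * n := by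
      rw [inv_mul_le_iff₀ hs0]; linarith
    have h2 : τ ^ 2 * (2 ^ 17 * Real.exp 1 * k) ≤ 2 ^ 20 * Real.exp 1 * (n * p) := by
      have : τ ^ 2 * k ≤ 8 * (n * p) := by
        have h := mul_le_mul_of_nonneg_left hk2 (sq_nonneg τ)
        calc _ ≤ _ := h
          _ = _ := by rw [hs_def]; field_simp; ring
      nlinarith [Real.exp_pos 1]
    calc τ ^ (2 * k) * (s⁻¹ * (4 * k) * (2 ^ 17 * Real.exp 1 * k) ^ k)
        = s⁻¹ * (4 * k) * (τ ^ 2 * (2 ^ 17 * Real.exp 1 * k)) ^ k := by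
          rw [mul_pow (τ ^ 2), pow_mul]; ring
      _ ≤ 2 ^ k * (2 ^ 20 * Real.exp 1 * (n * p)) ^ k := by
          gcongr
          exact h1.trans hk3
      _ = _ := by rw [← mul_pow]; ring
  have hgm' : Measurable fun x => (ENNReal.ofReal τ * g x) ^ (2 * k) :=
    (hgm.const_mul _).pow_const _
  have hlyap := lintegral_rpow_le_rpow_lintegral (μ := Measure.pi fun _ : Fin n × Fin n => ν)
    hgm'.aemeasurable (a := r / (2 * k)) (by positivity) ((div_le_one (by positivity)).mpr hk4)
  have hexp : ∀ x, ((ENNReal.ofReal τ * g x) ^ (2 * k)) ^ (r / (2 * k)) =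
      (ENNReal.ofReal τ * g x) ^ r := fun x => by
    rw [← ENNReal.rpow_natCast, ← ENNReal.rpow_mul]
    congr 1
    push_cast
    field_simp
  simp_rw [hexp] at hlyap
  refine hlyap.trans ((ENNReal.rpow_le_rpow hhigh (by positivity)).trans_eq ?_)
  rw [ENNReal.ofReal_rpow_of_nonneg (by positivity) (by positivity)]
  congr 1
  rw [← Real.rpow_natCast, ← Real.rpow_mul (by positivity),
    show (k : ℝ) * (r / (2 * k)) = r / 2 by field_simp, Real.mul_rpow (by positivity) (by positivity),
    Real.sqrt_eq_rpow, ← Real.rpow_mul (by positivity)]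
  congr 2
  ring

/-! ### The critical exponent and the choice of the truncation level -/

lemma four_lt_critExp {α : ℝ} (h0 : 0 < α) (h1 : α < 1) : 4 < critExp α := by
  unfold critExp
  rw [lt_div_iff₀ (by linarith)]
  linarith

lemma critExp_half_sub_one {α : ℝ} (h1 : α < 1) : critExp α / 2 - 1 = (1 - α)⁻¹ := by
  have : 1 - α ≠ 0 := by linarith
  unfold critExp
  field_simp
  ring

/-- If `p ≥ c n^{-α}` then `n` is dominated by `(n p)^{q/2-1}`. -/
lemma le_mul_rpow_critExp {α c N p : ℝ} (h1 : α < 1) (hc : 0 < c) (hN : 0 < N)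
    (hp : c * N ^ (-α) ≤ p) :
    N ≤ (c ^ (1 - α)⁻¹)⁻¹ * (N * p) ^ (critExp α / 2 - 1) := by
  have h1' : 0 < 1 - α := by linarith
  rw [critExp_half_sub_one h1, le_inv_mul_iff₀ (by positivity)]
  have h : c * N ^ (1 - α) ≤ N * p := by
    calc c * N ^ (1 - α) = N * (c * N ^ (-α)) := by
          rw [sub_eq_add_neg, Real.rpow_add hN, Real.rpow_one]; ring
      _ ≤ _ := by gcongr
  calc c ^ (1 - α)⁻¹ * N = (c * N ^ (1 - α)) ^ (1 - α)⁻¹ := by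
        rw [Real.mul_rpow hc.le (by positivity), Real.rpow_rpow_inv hN.le h1'.ne']
    _ ≤ _ := by gcongr

/-- The truncation level. -/
def truncLevel (q N p : ℝ) : ℝ := √(N * p) * N ^ (-(1 / (2 * q)))

lemma truncLevel_pos {q N p : ℝ} (hN : 0 < N) (hp : 0 < p) : 0 < truncLevel q N p := by
  unfold truncLevel; positivity

/-- The factor `N ^ (-(1 / (2 * q)))` in the truncation level is a compromise. Here it makes `n s`
grow like a power of `N`, so that exponentials in `k` beat `N`; in `truncLevel_rpow` it costs only
`N ^ (-1/2)`, so large entries stay rare. -/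
lemma mul_four_mul_div_truncLevel_sq {q N p : ℝ} (hN : 0 < N) (hp : 0 < p) :
    N * (4 * p / truncLevel q N p ^ 2) = 4 * N ^ (1 / q) := by
  unfold truncLevel
  rw [mul_pow, Real.sq_sqrt (by positivity), ← Real.rpow_natCast, ← Real.rpow_mul hN.le,
    show -(1 / (2 * q)) * ((2 : ℕ) : ℝ) = -(1 / q) by push_cast; ring, Real.rpow_neg hN.le]
  field_simp

lemma truncLevel_rpow {q N p : ℝ} (hq : 0 < q) (hN : 0 < N) (hp : 0 < p) :
    truncLevel q N p ^ q = (N * p) ^ (q / 2) * N ^ (-(1 / 2) : ℝ) := by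
  unfold truncLevel
  rw [Real.mul_rpow (by positivity) (by positivity), Real.sqrt_eq_rpow,
    ← Real.rpow_mul (by positivity), ← Real.rpow_mul hN.le]
  congr 2
  · ring
  · field_simp

lemma measure_lt_abs_le {ν : Measure ℝ} {τ q b : ℝ} (hτ : 0 < τ) (hq : 0 < q)
    (hB : ∫⁻ y, ‖y‖ₑ ^ q ∂ν ≤ ENNReal.ofReal b) :
    ν {y | τ < |y|} ≤ ENNReal.ofReal (b / τ ^ q) := by
  have hτq : 0 < τ ^ q := by positivity
  have h := meas_ge_le_lintegral_div (μ := ν) (f := fun y : ℝ => ‖y‖ₑ ^ q) (by fun_prop)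
    (ε := ENNReal.ofReal (τ ^ q)) (by simpa using hτq) ENNReal.ofReal_ne_top
  rw [ENNReal.ofReal_div_of_pos hτq]
  refine (measure_mono fun y hy => ?_).trans (h.trans (by gcongr))
  simp only [Set.mem_ofPred_eq] at hy ⊢
  rw [← ofReal_norm, ENNReal.ofReal_rpow_of_nonneg (norm_nonneg _) hq.le, Real.norm_eq_abs]
  exact ENNReal.ofReal_le_ofReal (Real.rpow_le_rpow hτ.le hy.le hq.le)

/-- The inequality `n ≤ c₁ (n p) ^ (q / 2 - 1)` serves twice: in `hmass` it gives the maximal entry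
the size `√(n p)` in `L^q`, and in `htail` it leaves `O(n ^ (-1/2))` expected large entries per row.
-/
lemma lintegral_specNorm_largePart_le_sqrt {α c b p r : ℝ} {n d : ℕ} {ν : Measure ℝ}
    [IsProbabilityMeasure ν] (h0 : 0 < α) (h1 : α < 1) (hc : 0 < c) (hb : 0 ≤ b) (hn : 1 ≤ n)
    (hp0 : 0 < p) (hp : c * (n : ℝ) ^ (-α) ≤ p) (hr : 0 < r) (hrq : r < critExp α)
    (hd : 2 * (r / (1 - r / critExp α)) + 2 ≤ d + 1)
    (hB : ∫⁻ y, ‖y‖ₑ ^ critExp α ∂ν ≤ ENNReal.ofReal (b * p)) :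
    ∫⁻ x, ENNReal.ofReal (specNorm (entryMatrix fun e =>
        largePart (truncLevel (critExp α) n p) (x e))) ^ r
      ∂(Measure.pi fun _ : Fin n × Fin n => ν) ≤
    ENNReal.ofReal (((c ^ (1 - α)⁻¹)⁻¹ * b) ^ (r / critExp α) *
      (d ^ r + (2 * ((c ^ (1 - α)⁻¹)⁻¹ * b) ^ (d + 1)) ^ (1 - r / critExp α)) *
        √(n * p) ^ r) := by
  have hN : (0 : ℝ) < n := by exact_mod_cast hn
  have hN1 : (1 : ℝ) ≤ n := by exact_mod_cast hn
  have hstar := le_mul_rpow_critExp h1 hc hN hp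
  set q := critExp α with hq_def
  have hq : 0 < q := hr.trans hrq
  set c₁ := (c ^ (1 - α)⁻¹)⁻¹ with hc₁
  have hc₁0 : 0 < c₁ := by positivity
  set τ := truncLevel q n p with hτ_def
  have hτ : 0 < τ := truncLevel_pos hN hp0
  have hθ : 0 < 1 - r / q := by
    rw [sub_pos, div_lt_one hq]; exact hrq
  have hnp : (0 : ℝ) < n * p := by positivity
  have hpow : (n * p : ℝ) ^ (q / 2) = (n * p) ^ (q / 2 - 1) * (n * p) := by
    rw [Real.rpow_sub_one hnp.ne']; field_simp
  have htail : (n : ℝ≥0∞) * ν {y | τ < |y|} ≤ ENNReal.ofReal (c₁ * b * (n : ℝ) ^ (-(1 / 2) : ℝ)) := by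
    rw [← ENNReal.ofReal_natCast]
    refine (mul_le_mul_right (measure_lt_abs_le hτ hq hB) _).trans ?_
    rw [← ENNReal.ofReal_mul hN.le]
    refine ENNReal.ofReal_le_ofReal ?_
    rw [truncLevel_rpow hq hN hp0, hpow, mul_div_assoc', div_le_iff₀ (by positivity)]
    have hsq : (n : ℝ) ^ (-(1 / 2) : ℝ) * (n : ℝ) ^ (-(1 / 2) : ℝ) = (n : ℝ)⁻¹ := by
      rw [← Real.rpow_add hN, ← Real.rpow_neg_one]; norm_num
    calc n * (b * p) = b * (n * p) * ((n : ℝ)⁻¹ * n) := by field_simp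
      _ ≤ b * (n * p) * ((n : ℝ)⁻¹ * (c₁ * (n * p) ^ (q / 2 - 1))) := by gcongr
      _ = _ := by rw [← hsq]; ring
  have hmass : (n : ℝ≥0∞) * n * ∫⁻ y, ‖y‖ₑ ^ q ∂ν ≤ ENNReal.ofReal (c₁ * b * (n * p) ^ (q / 2)) := by
    rw [← ENNReal.ofReal_natCast, ← ENNReal.ofReal_mul hN.le]
    refine (mul_le_mul_right hB _).trans ?_
    rw [← ENNReal.ofReal_mul (by positivity)]
    refine ENNReal.ofReal_le_ofReal ?_
    rw [hpow]
    calc (n : ℝ) * n * (b * p) = b * (n * p) * n := by ring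
      _ ≤ b * (n * p) * (c₁ * (n * p) ^ (q / 2 - 1)) := by gcongr
      _ = _ := by ring
  refine (lintegral_specNorm_largePart_le (d := d) hr hrq).trans ?_
  have hfirst : ((n : ℝ≥0∞) * n * ∫⁻ y, ‖y‖ₑ ^ q ∂ν) ^ (r / q) ≤
      ENNReal.ofReal ((c₁ * b) ^ (r / q) * √(n * p) ^ r) := by
    refine (ENNReal.rpow_le_rpow hmass (by positivity)).trans_eq ?_
    rw [ENNReal.ofReal_rpow_of_nonneg (by positivity) (by positivity),
      Real.mul_rpow (by positivity) (by positivity), ← Real.rpow_mul hnp.le, Real.sqrt_eq_rpow,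
      ← Real.rpow_mul hnp.le]
    congr 3
    field_simp
  have hsecond : (n : ℝ≥0∞) ^ r * (2 * n * (n * ν {y | τ < |y|}) ^ (d + 1)) ^ (1 - r / q) ≤
      ENNReal.ofReal ((2 * (c₁ * b) ^ (d + 1)) ^ (1 - r / q)) := by
    calc _ ≤ (n : ℝ≥0∞) ^ r * (2 * n * (ENNReal.ofReal (c₁ * b * (n : ℝ) ^ (-(1 / 2) : ℝ))) ^ (d + 1))
          ^ (1 - r / q) := by gcongr
      _ = ENNReal.ofReal ((n : ℝ) ^ r * (2 * n * (c₁ * b * (n : ℝ) ^ (-(1 / 2) : ℝ)) ^ (d + 1))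
          ^ (1 - r / q)) := by
          rw [← ENNReal.ofReal_natCast, ENNReal.ofReal_rpow_of_nonneg hN.le hr.le,
            ← ENNReal.ofReal_ofNat 2, ← ENNReal.ofReal_pow (by positivity),
            ← ENNReal.ofReal_mul (by positivity), ← ENNReal.ofReal_mul (by positivity),
            ENNReal.ofReal_rpow_of_nonneg (by positivity) hθ.le,
            ← ENNReal.ofReal_mul (by positivity)]
      _ ≤ _ := by
          refine ENNReal.ofReal_le_ofReal ?_
          -- The remaining power of `n` is `r + (1 - (d + 1) / 2) * (1 - r / q)`, and `hd` says
          -- exactly that it is nonpositive.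
          have hre : 2 * (n : ℝ) * (c₁ * b * (n : ℝ) ^ (-(1 / 2) : ℝ)) ^ (d + 1) =
              2 * (c₁ * b) ^ (d + 1) * (n : ℝ) ^ (1 - ((d : ℝ) + 1) / 2) := by
            rw [mul_pow, ← Real.rpow_mul_natCast hN.le, sub_eq_add_neg, Real.rpow_add hN,
              Real.rpow_one, show -(1 / 2) * ((d + 1 : ℕ) : ℝ) = -(((d : ℝ) + 1) / 2) by
                push_cast; ring]
            ring
          rw [hre, Real.mul_rpow (by positivity) (by positivity), mul_left_comm,
            ← Real.rpow_mul hN.le, ← Real.rpow_add hN]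
          refine mul_le_of_le_one_right (by positivity) ?_
          refine Real.rpow_le_one_of_one_le_of_nonpos hN1 ?_
          have : r / (1 - r / q) * (1 - r / q) = r := div_mul_cancel₀ _ hθ.ne'
          nlinarith
  have hthird : (d : ℝ≥0∞) ^ r = ENNReal.ofReal ((d : ℝ) ^ r) := by
    rw [← ENNReal.ofReal_rpow_of_nonneg (by positivity) hr.le, ENNReal.ofReal_natCast]
  refine (mul_le_mul' hfirst (add_le_add hthird.le hsecond)).trans_eq ?_
  rw [← ENNReal.ofReal_add (by positivity) (by positivity), ← ENNReal.ofReal_mul (by positivity)]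
  congr 1
  ring

/-- A power of two within a factor of two above a given real number. -/
lemma exists_two_pow_between {x : ℝ} (hx : 2 ≤ x) :
    ∃ l : ℕ, x ≤ ((2 ^ (l + 1) : ℕ) : ℝ) ∧ ((2 ^ (l + 1) : ℕ) : ℝ) ≤ 2 * x := by
  obtain ⟨m, hm1, hm2⟩ := exists_nat_pow_near (by linarith : 1 ≤ x) one_lt_two
  refine ⟨m, ?_, ?_⟩
  · push_cast; exact hm2.le
  · push_cast; rw [pow_succ]; linarith

/-- The size requirements under which the truncated part can be handled. -/
lemma eventually_size_conditions {q : ℝ} (hq : 1 < q) (r : ℝ) :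
    ∀ᶠ n : ℕ in atTop, 4 * (n : ℝ) ^ (1 / q) ≤ n ∧ 8 * (n : ℝ) ≤ 2 ^ (4 * (n : ℝ) ^ (1 / q)) ∧
      r ≤ 4 * (n : ℝ) ^ (1 / q) := by
  have hq0 : 0 < 1 / q := by positivity
  have hcast := tendsto_natCast_atTop_atTop (R := ℝ)
  have h1 : ∀ᶠ x : ℝ in atTop, 4 * x ^ (1 / q) ≤ x := by
    have hlt : 1 / q < 1 := by rw [div_lt_one] <;> linarith
    have h := (tendsto_rpow_atTop (sub_pos.mpr hlt)).eventually_ge_atTop (4 : ℝ)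
    filter_upwards [h, eventually_gt_atTop 0] with x hx hx0
    calc 4 * x ^ (1 / q) ≤ x ^ (1 - 1 / q) * x ^ (1 / q) := by gcongr
      _ = x := by rw [← Real.rpow_add hx0]; simp
  have h2 : ∀ᶠ x : ℝ in atTop, 8 * x ≤ 2 ^ (4 * x ^ (1 / q)) := by
    have h := (isLittleO_log_rpow_atTop hq0).bound (c := Real.log 2) (Real.log_pos (by norm_num))
    have h' := (tendsto_rpow_atTop hq0).eventually_ge_atTop (1 : ℝ)
    filter_upwards [h, h', eventually_gt_atTop 1] with x hx hx1 hx0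
    have hx' : 0 < x := by linarith
    rw [Real.norm_of_nonneg (Real.log_pos hx0).le, Real.norm_of_nonneg (by positivity)] at hx
    rw [Real.rpow_def_of_pos (by norm_num), ← Real.exp_log (by positivity : 0 < 8 * x),
      Real.exp_le_exp, Real.log_mul (by norm_num) hx'.ne',
      show (8 : ℝ) = 2 ^ 3 by norm_num, Real.log_pow]
    push_cast
    have := Real.log_pos (by norm_num : (1 : ℝ) < 2)
    nlinarith
  have h3 := (tendsto_rpow_atTop hq0).eventually_ge_atTop (r / 4)
  filter_upwards [hcast.eventually h1, hcast.eventually h2, hcast.eventually h3] with n a1 a2 a3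
  exact ⟨a1, a2, by linarith⟩

/-- The norm bound for matrices with independent symmetric entries. -/
lemma lintegral_specNorm_symm_le {α c b r : ℝ} (h0 : 0 < α) (h1 : α < 1) (hc : 0 < c) (hb : 0 ≤ b)
    (hr : 1 ≤ r) (hrq : r < critExp α) :
    ∃ C : ℝ, 0 < C ∧ ∀ᶠ n : ℕ in atTop, ∀ (p : ℝ) (ν : Measure ℝ), IsProbabilityMeasure ν →
      0 < p → c * (n : ℝ) ^ (-α) ≤ p → ν.map (fun y => -y) = ν →
      ∫⁻ y, ‖y‖ₑ ^ (2 : ℝ) ∂ν ≤ ENNReal.ofReal (4 * p) →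
      ∫⁻ y, ‖y‖ₑ ^ critExp α ∂ν ≤ ENNReal.ofReal (b * p) →
      ∫⁻ x, ENNReal.ofReal (specNorm (entryMatrix x)) ^ r
        ∂(Measure.pi fun _ : Fin n × Fin n => ν) ≤ ENNReal.ofReal (C * √(n * p) ^ r) := by
  have hr0 : 0 < r := by linarith
  have hq4 := four_lt_critExp h0 h1
  obtain ⟨d, hd⟩ := exists_nat_ge (2 * (r / (1 - r / critExp α)) + 2)
  set C₁ := (2 ^ 21 * Real.exp 1) ^ (r / 2) with hC₁
  set C₂ := ((c ^ (1 - α)⁻¹)⁻¹ * b) ^ (r / critExp α) *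
      (d ^ r + (2 * ((c ^ (1 - α)⁻¹)⁻¹ * b) ^ (d + 1)) ^ (1 - r / critExp α)) with hC₂
  have hC₁0 : 0 < C₁ := by positivity
  have hC₂0 : 0 ≤ C₂ := by positivity
  refine ⟨2 ^ (r - 1) * (C₁ + C₂), by positivity, ?_⟩
  filter_upwards [eventually_size_conditions (by linarith : 1 < critExp α) r,
    eventually_ge_atTop 1] with n ⟨hn1, hn2, hn3⟩ hn p ν _ hp0 hp hsymm hv hB
  have hN : (0 : ℝ) < n := by exact_mod_cast hn
  have hN1 : (1 : ℝ) ≤ n := by exact_mod_cast hn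
  set q := critExp α
  set τ := truncLevel q n p with hτ_def
  have hτ : 0 < τ := truncLevel_pos hN hp0
  have hns : n * (4 * p / τ ^ 2) = 4 * (n : ℝ) ^ (1 / q) := mul_four_mul_div_truncLevel_sq hN hp0
  have hone : 1 ≤ (n : ℝ) ^ (1 / q) := Real.one_le_rpow hN1 (by positivity)
  -- The order `k` must be a power of two for the trace bound and comparable to `n s = 4 n ^ (1 /
  -- q)` for the comparison with signs.
  obtain ⟨l, hl1, hl2⟩ := exists_two_pow_between (by linarith : 2 ≤ 4 * (n : ℝ) ^ (1 / q))
  have hsmall := lintegral_specNorm_smallPart_le (n := n) (l := l) hsymm hτ hp0 hr0 hv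
    (by
      have : n * (4 * p / τ ^ 2) ≤ n * 1 := by rw [hns]; linarith
      exact le_of_mul_le_mul_left this hN) rfl (by rw [hns]; exact hl1) (by rw [hns]; exact hl2)
    (hn2.trans (by
      rw [← Real.rpow_natCast]
      exact Real.rpow_le_rpow_of_exponent_le (by norm_num) hl1)) (by linarith)
  have hlarge := lintegral_specNorm_largePart_le_sqrt (n := n) (d := d) h0 h1 hc hb hn hp0 hp hr0
    hrq (by linarith) hB
  have hmL : Measurable fun x : Fin n × Fin n → ℝ =>
      ENNReal.ofReal (specNorm (entryMatrix fun e => largePart τ (x e))) ^ r :=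
    (measurable_specNorm_entryMatrix.comp (measurable_pi_lambda _ fun e =>
      (measurable_largePart τ).comp (measurable_pi_apply e))).ennreal_ofReal.pow_const r
  calc _ ≤ ∫⁻ x, 2 ^ (r - 1) *
        (ENNReal.ofReal (τ * specNorm (entryMatrix fun e => smallPart τ (x e))) ^ r +
        ENNReal.ofReal (specNorm (entryMatrix fun e => largePart τ (x e))) ^ r)
        ∂(Measure.pi fun _ : Fin n × Fin n => ν) := by
        refine lintegral_mono fun x => ?_
        refine le_trans ?_ (ENNReal.rpow_add_le_mul_rpow_add_rpow _ _ hr)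
        refine ENNReal.rpow_le_rpow ?_ hr0.le
        rw [← ENNReal.ofReal_add (mul_nonneg hτ.le (specNorm_nonneg _)) (specNorm_nonneg _)]
        refine ENNReal.ofReal_le_ofReal ?_
        conv_lhs => rw [smul_smallPart_add_largePart hτ x]
        refine (specNorm_add_le _ _).trans_eq ?_
        rw [specNorm_smul, abs_of_pos hτ]
    _ ≤ 2 ^ (r - 1) * (ENNReal.ofReal (C₁ * √(n * p) ^ r) +
        ENNReal.ofReal (C₂ * √(n * p) ^ r)) := by
        rw [lintegral_const_mul' _ _ (by
          exact ENNReal.rpow_ne_top_of_nonneg (by linarith) (by norm_num)),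
          lintegral_add_right _ hmL]
        gcongr
    _ = _ := by
        rw [← ENNReal.ofReal_ofNat 2, ENNReal.ofReal_rpow_of_pos (by norm_num),
          ← ENNReal.ofReal_add (by positivity) (by positivity),
          ← ENNReal.ofReal_mul (by positivity)]
        congr 1
        simp only [OfNat.ofNat]
        ring

/-! ### The upper bound -/

lemma IsSparseModel.measurable_specNorm {Ω : Type*} [MeasurableSpace Ω] {P : Measure Ω} {n : ℕ}
    {p : ℝ} {ρ : Measure ℝ} {δ ξ : Fin n → Fin n → Ω → ℝ} (h : IsSparseModel P n p ρ δ ξ) :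
    Measurable fun ω => specNorm (sparseMatrix δ ξ ω) :=
  measurable_specNorm_entryMatrix.comp (g := fun x : Fin n × Fin n → ℝ => specNorm (entryMatrix x))
    (f := fun ω e => δ e.1 e.2 ω * ξ e.1 e.2 ω)
    (measurable_pi_lambda _ fun _ => (h.measurable_delta _ _).mul (h.measurable_xi _ _))

lemma NormMomentBound.mono_const {q r C C' p : ℝ} {K M : ℝ≥0} {n : ℕ} (hC : C ≤ C')
    (h : NormMomentBound.{u} q K M r C n p) : NormMomentBound.{u} q K M r C' n p := by
  intro ρ h1 h2 h3 h4 h5 Ω _ P _ δ ξ hm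
  refine (h ρ h1 h2 h3 h4 h5 Ω P δ ξ hm).trans (ENNReal.ofReal_le_ofReal ?_)
  gcongr

lemma NormMomentBound.of_exponent_le {q r r' C p : ℝ} {K M : ℝ≥0} {n : ℕ} (hr : 0 < r)
    (hrr : r ≤ r') (hC : 0 ≤ C) (h : NormMomentBound.{u} q K M r' C n p) :
    NormMomentBound.{u} q K M r (C ^ (r / r')) n p := by
  intro ρ h1 h2 h3 h4 h5 Ω _ P _ δ ξ hm
  have hr' : 0 < r' := hr.trans_le hrr
  have hmeas : Measurable fun ω => ENNReal.ofReal (specNorm (sparseMatrix δ ξ ω)) ^ r' :=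
    hm.measurable_specNorm.ennreal_ofReal.pow_const r'
  have hl := lintegral_rpow_le_rpow_lintegral (μ := P) hmeas.aemeasurable (a := r / r')
    (by positivity) ((div_le_one hr').mpr hrr)
  have he : r' * (r / r') = r := by field_simp
  simp_rw [← ENNReal.rpow_mul, he] at hl
  refine hl.trans ((ENNReal.rpow_le_rpow (h ρ h1 h2 h3 h4 h5 Ω P δ ξ hm)
    (by positivity)).trans_eq ?_)
  rw [ENNReal.ofReal_rpow_of_nonneg (by positivity) (by positivity),
    Real.mul_rpow hC (by positivity), ← Real.rpow_mul (by positivity), he]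

lemma lintegral_sq_eq_one {ρ : Measure ℝ} (hc : IsCentered ρ)
    (hv : Var[fun x : ℝ => x; ρ] = 1) : ∫⁻ y, ‖y‖ₑ ^ (2 : ℝ) ∂ρ = 1 := by
  rw [variance, ENNReal.toReal_eq_one_iff, evariance] at hv
  rw [← hv]
  refine lintegral_congr fun y => ?_
  rw [hc.2, sub_zero]
  norm_num

lemma lintegral_entryLaw_rpow {p : ℝ} (h0 : 0 ≤ p) (h1 : p ≤ 1) (ρ : Measure ℝ)
    [IsProbabilityMeasure ρ] {q : ℝ} (hq : 0 < q) :
    ∫⁻ y, ‖y‖ₑ ^ q ∂(entryLaw p ρ) = ENNReal.ofReal p * ∫⁻ y, ‖y‖ₑ ^ q ∂ρ := by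
  rw [lintegral_entryLaw h0 h1 ρ (by fun_prop)]
  simp [hq]

lemma isCentered_entryLaw {p : ℝ} (h0 : 0 ≤ p) (h1 : p ≤ 1) {ρ : Measure ℝ}
    [IsProbabilityMeasure ρ] (hc : IsCentered ρ) : IsCentered (entryLaw p ρ) := by
  have := isProbabilityMeasure_berLaw h0 h1
  have hi : Integrable (fun x : ℝ => x) (berLaw p) :=
    ((integrable_dirac (by simp)).smul_measure ENNReal.ofReal_ne_top).add_measure
      ((integrable_dirac (by simp)).smul_measure ENNReal.ofReal_ne_top)
  constructor
  · rw [entryLaw, integrable_map_measure (by fun_prop) (by fun_prop)]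
    exact hi.mul_prod hc.1
  · rw [entryLaw, integral_map (by fun_prop) (by fun_prop), integral_prod_mul (fun x : ℝ => x)
      (fun x : ℝ => x), hc.2, mul_zero]

lemma exists_normMomentBound_eventually {α r : ℝ} (h0 : 0 < α) (h1 : α < 1) (hr : 1 ≤ r)
    (hrq : r < critExp α) (K M : ℝ≥0) {κ : ℝ} (hκ : 0 < κ) :
    ∃ C : ℝ, 0 < C ∧ ∀ p : ℕ → ℝ, (∀ n, 1 ≤ n → 0 < p n ∧ p n ≤ 1) →
      OmegaWith κ p (fun n => (n : ℝ) ^ (-α)) →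
      ∀ᶠ n in atTop, NormMomentBound.{u} (critExp α) K M r C n (p n) := by
  have hq4 := four_lt_critExp h0 h1
  -- A liminf at least `κ` only yields `p n > (κ / 2) n ^ (-α)` eventually; the factor `2` in `b`
  -- comes from symmetrization. Both `C` and the threshold in `hev` are fixed before `p` and `ρ`.
  obtain ⟨C, hC, hev⟩ := lintegral_specNorm_symm_le (c := κ / 2) (b := (2 * K) ^ critExp α)
    h0 h1 (by positivity) (by positivity) hr hrq
  refine ⟨C, hC, fun p hp hΩ => ?_⟩
  have hlow : ∀ᶠ n : ℕ in atTop, ((κ / 2 : ℝ) : EReal) < ((p n / (n : ℝ) ^ (-α) : ℝ) : EReal) :=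
    eventually_lt_of_lt_liminf (lt_of_lt_of_le (EReal.coe_lt_coe_iff.mpr (half_lt_self hκ)) hΩ)
  filter_upwards [hev, hlow, eventually_ge_atTop 1] with n hn hlow hn1
  obtain ⟨hp0, hp1⟩ := hp n hn1
  have hN : (0 : ℝ) < n := by exact_mod_cast hn1
  intro ρ _ hcent hvar _ hK Ω _ P _ δ ξ hm
  rw [hm.lintegral_specNorm_eq hp0.le hp1
    (f := fun t => ENNReal.ofReal t ^ r) (by fun_prop)]
  have := isProbabilityMeasure_entryLaw hp0.le hp1 ρ
  have hcent' := isCentered_entryLaw hp0.le hp1 hcent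
  refine (lintegral_specNorm_rpow_le_symmLaw hcent'.1 hcent'.2 hr).trans ?_
  refine hn (p n) (symmLaw (entryLaw (p n) ρ)) inferInstance hp0 ?_ (map_neg_symmLaw _) ?_ ?_
  · rw [EReal.coe_lt_coe_iff, lt_div_iff₀ (by positivity)] at hlow
    exact hlow.le
  -- The convexity bound gives `4 * p`; the exact second moment is `2 * p`.
  · refine (lintegral_symmLaw_rpow_le (by norm_num)).trans_eq ?_
    rw [lintegral_entryLaw_rpow hp0.le hp1 ρ (by norm_num), lintegral_sq_eq_one hcent hvar, mul_one,
      ENNReal.ofReal_mul (by norm_num), show (4 : ℝ) = 2 ^ (2 : ℝ) by norm_num,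
      ← ENNReal.ofReal_rpow_of_pos (by norm_num)]
    simp
  · refine (lintegral_symmLaw_rpow_le (by linarith)).trans ?_
    rw [lintegral_entryLaw_rpow hp0.le hp1 ρ (by linarith)]
    calc _ ≤ 2 ^ critExp α * (ENNReal.ofReal (p n) * (K : ℝ≥0∞) ^ critExp α) := by
          gcongr
          exact hK.le
      _ = _ := by
          rw [ENNReal.ofReal_mul (by positivity), ← ENNReal.ofReal_rpow_of_nonneg (by positivity)
            (by linarith), ENNReal.ofReal_mul (by norm_num), ENNReal.ofReal_coe_nnreal,
            ENNReal.mul_rpow_of_nonneg _ _ (by linarith), ENNReal.ofReal_ofNat]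
          ring

/-- A crude bound for a single `n`, uniform in `ρ`, used for the finitely many sizes that the
asymptotic bound misses. At level `-1` every entry counts as large, so the bound for large parts
applies to the whole matrix. -/
lemma exists_normMomentBound {q r p : ℝ} (hr : 0 < r) (hrq : r < q) (K M : ℝ≥0) {n : ℕ}
    (hn : 1 ≤ n) (hp0 : 0 < p) (hp1 : p ≤ 1) :
    ∃ C : ℝ, 0 < C ∧ NormMomentBound.{u} q K M r C n p := by
  have hN : (0 : ℝ) < n := by exact_mod_cast hn
  have hq : 0 < q := hr.trans hrq
  have hθ : 0 ≤ 1 - r / q := by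
    rw [sub_nonneg, div_le_one hq]; exact hrq.le
  set X : ℝ≥0∞ := (n * n * (K : ℝ≥0∞) ^ q) ^ (r / q) *
      (n ^ r + n ^ r * (2 * n * (n * 1) ^ (n + 1)) ^ (1 - r / q)) with hX
  have hXtop : X ≠ ∞ := by
    have hn_top : (n : ℝ≥0∞) ≠ ∞ := ENNReal.natCast_ne_top n
    have h1 : (n : ℝ≥0∞) ^ r ≠ ∞ := ENNReal.rpow_ne_top_of_nonneg hr.le hn_top
    refine ENNReal.mul_ne_top (ENNReal.rpow_ne_top_of_nonneg (by positivity)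
      (ENNReal.mul_ne_top (ENNReal.mul_ne_top hn_top hn_top)
        (ENNReal.rpow_ne_top_of_nonneg hq.le ENNReal.coe_ne_top)))
      (ENNReal.add_ne_top.mpr ⟨h1, ENNReal.mul_ne_top h1 (ENNReal.rpow_ne_top_of_nonneg hθ
        (ENNReal.mul_ne_top (ENNReal.mul_ne_top (by norm_num) hn_top)
          (ENNReal.pow_ne_top (by simp))))⟩)
  have hs : 0 < √(n * p) ^ r := by positivity
  refine ⟨X.toReal / √(n * p) ^ r + 1, by positivity, ?_⟩
  intro ρ _ hcent hvar _ hK Ω _ P _ δ ξ hm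
  rw [hm.lintegral_specNorm_eq hp0.le hp1
    (f := fun t => ENNReal.ofReal t ^ r) (by fun_prop)]
  have := isProbabilityMeasure_entryLaw hp0.le hp1 ρ
  have hlarge := lintegral_specNorm_largePart_le (n := n) (d := n) (ν := entryLaw p ρ) (τ := -1)
    hr hrq
  have hid : ∀ y, largePart (-1) y = y := fun y =>
    if_neg (by linarith [abs_nonneg y])
  simp_rw [hid] at hlarge
  refine hlarge.trans (le_trans ?_ (b := X) ?_)
  · rw [hX]
    gcongr
    · rw [lintegral_entryLaw_rpow hp0.le hp1 ρ hq]
      calc _ ≤ 1 * (K : ℝ≥0∞) ^ q := by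
            gcongr
            · exact ENNReal.ofReal_le_one.mpr hp1
            · exact hK.le
        _ = _ := one_mul _
    · exact prob_le_one
  · rw [← ENNReal.ofReal_toReal hXtop]
    refine ENNReal.ofReal_le_ofReal ?_
    rw [ENNReal.toReal_ofReal ENNReal.toReal_nonneg, add_mul, div_mul_cancel₀ _ hs.ne']
    linarith

/-- The upper bound with a constant that depends on `p` only through its `Ω`-constant. -/
theorem normMomentBound_of_omegaWith {α r : ℝ} (h0 : 0 < α) (h1 : α < 1) (hr : 0 < r)
    (hrq : r < critExp α) (K M : ℝ≥0) {κ : ℝ} (hκ : 0 < κ) :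
    ∃ C : ℝ, 0 < C ∧ ∀ p : ℕ → ℝ, (∀ n, 1 ≤ n → 0 < p n ∧ p n ≤ 1) →
      OmegaWith κ p (fun n => (n : ℝ) ^ (-α)) →
      ∀ᶠ n in atTop, NormMomentBound.{u} (critExp α) K M r C n (p n) := by
  have hq4 := four_lt_critExp h0 h1
  -- Symmetrization by Jensen needs an exponent at least one; `max r 1` is still below the critical
  -- exponent, which exceeds four.
  obtain ⟨C, hC, h⟩ := exists_normMomentBound_eventually.{u} h0 h1 (r := max r 1)
    (le_max_right _ _) (max_lt hrq (by linarith)) K M hκ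
  refine ⟨C ^ (r / max r 1), by positivity, fun p hp hΩ => ?_⟩
  filter_upwards [h p hp hΩ] with n hn
  exact hn.of_exponent_le hr (le_max_left _ _) hC.le

/-- The upper bound for all sizes, with a constant that depends on the sequence `p`. -/
theorem normMomentBound_of_isOmega {α r : ℝ} (h0 : 0 < α) (h1 : α < 1) (hr : 0 < r)
    (hrq : r < critExp α) (K M : ℝ≥0) {p : ℕ → ℝ} (hp : ∀ n, 1 ≤ n → 0 < p n ∧ p n ≤ 1)
    (hΩ : IsOmega p fun n => (n : ℝ) ^ (-α)) :
    ∃ C : ℝ, 0 < C ∧ ∀ n, 1 ≤ n → NormMomentBound.{u} (critExp α) K M r C n (p n) := by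
  obtain ⟨κ, hκ, hΩ⟩ := hΩ
  obtain ⟨C, hC, h⟩ := normMomentBound_of_omegaWith.{u} h0 h1 hr hrq K M hκ
  obtain ⟨N, hN⟩ := eventually_atTop.mp (h p hp hΩ)
  have hsmall : ∀ n : ℕ, ∃ D : ℝ, 0 < D ∧
      (1 ≤ n → NormMomentBound.{u} (critExp α) K M r D n (p n)) := fun n => by
    by_cases hn : 1 ≤ n
    · obtain ⟨D, hD, hb⟩ := exists_normMomentBound.{u} hr hrq K M hn (hp n hn).1 (hp n hn).2
      exact ⟨D, hD, fun _ => hb⟩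
    · exact ⟨1, one_pos, fun h => absurd h hn⟩
  choose D hD0 hD using hsmall
  have hsum : 0 ≤ ∑ m ∈ Finset.range N, D m := Finset.sum_nonneg fun m _ => (hD0 m).le
  refine ⟨C + ∑ m ∈ Finset.range N, D m, by positivity, fun n hn => ?_⟩
  rcases le_or_gt N n with hNn | hnN
  · exact (hN n hNn).mono_const (by linarith)
  · refine (hD n hn).mono_const ?_
    have := Finset.single_le_sum (f := D) (fun m _ => (hD0 m).le) (Finset.mem_range.mpr hnN)
    linarith

/-! ### A symmetric law with a prescribed polynomial tail -/

lemma lintegral_paretoMeasure_one (β : ℝ) {g : ℝ → ℝ≥0∞} (hg : Measurable g) :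
    ∫⁻ y, g y ∂(paretoMeasure 1 β) =
      ∫⁻ x in Set.Ioi 1, ENNReal.ofReal (β * x ^ (-(β + 1))) * g x := by
  have hpdf : Measurable (paretoPDF 1 β) := (measurable_paretoPDFReal 1 β).ennreal_ofReal
  rw [paretoMeasure, lintegral_withDensity_eq_lintegral_mul _ hpdf hg,
    setLIntegral_congr Ioi_ae_eq_Ici, ← lintegral_indicator measurableSet_Ici]
  refine lintegral_congr fun x => ?_
  rw [Pi.mul_apply, paretoPDF_eq]
  by_cases hx : x ∈ Set.Ici (1 : ℝ)
  · rw [Set.indicator_of_mem hx, if_pos (Set.mem_Ici.mp hx), Real.one_rpow, mul_one]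
  · rw [Set.indicator_of_notMem hx, if_neg (by simpa using hx)]
    simp

lemma lintegral_paretoMeasure_rpow {β : ℝ} (hβ : 0 < β) {s : ℝ} :
    ∫⁻ y, ‖y‖ₑ ^ s ∂(paretoMeasure 1 β) =
      ENNReal.ofReal β * ∫⁻ x in Set.Ioi 1, ENNReal.ofReal (x ^ (s - β - 1)) := by
  rw [lintegral_paretoMeasure_one β (by fun_prop),
    ← lintegral_const_mul' _ _ ENNReal.ofReal_ne_top]
  refine setLIntegral_congr_fun measurableSet_Ioi fun x hx => ?_
  have hx0 : 0 < x := one_pos.trans hx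
  rw [← ofReal_norm, Real.norm_of_nonneg hx0.le, ENNReal.ofReal_rpow_of_pos hx0,
    ← ENNReal.ofReal_mul (by positivity), ← ENNReal.ofReal_mul hβ.le, mul_assoc,
    ← Real.rpow_add hx0]
  congr 3
  ring

lemma lintegral_paretoMeasure_rpow_lt_top {β s : ℝ} (hβ : 0 < β) (hs : s < β) :
    ∫⁻ y, ‖y‖ₑ ^ s ∂(paretoMeasure 1 β) < ∞ := by
  rw [lintegral_paretoMeasure_rpow hβ]
  exact ENNReal.mul_lt_top ENNReal.ofReal_lt_top
    (integrableOn_Ioi_rpow_of_lt (by linarith) one_pos).lintegral_lt_top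

lemma lintegral_paretoMeasure_rpow_eq_top {β s : ℝ} (hβ : 0 < β) (hs : β ≤ s) :
    ∫⁻ y, ‖y‖ₑ ^ s ∂(paretoMeasure 1 β) = ∞ := by
  rw [lintegral_paretoMeasure_rpow hβ]
  refine ENNReal.mul_eq_top.mpr (Or.inl ⟨by simpa using hβ, ?_⟩)
  by_contra hfin
  have hi : IntegrableOn (fun x : ℝ => x ^ (s - β - 1)) (Set.Ioi 1) := by
    refine ⟨by fun_prop, ?_⟩
    rw [hasFiniteIntegral_iff_ofReal]
    · exact lt_top_iff_ne_top.mpr hfin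
    · filter_upwards [ae_restrict_mem measurableSet_Ioi] with x hx
      exact Real.rpow_nonneg (one_pos.trans hx).le _
  have := (integrableOn_Ioi_rpow_iff one_pos).mp hi
  linarith

lemma paretoMeasure_lt_abs {β t : ℝ} (hβ : 0 < β) (ht : 1 ≤ t) :
    paretoMeasure 1 β {y | t < |y|} = ENNReal.ofReal (t ^ (-β)) := by
  have ht0 : 0 < t := one_pos.trans_le ht
  have hm : MeasurableSet {y : ℝ | t < |y|} := measurableSet_lt measurable_const measurable_id.abs
  have hset : ∀ x ∈ Set.Ioi (1 : ℝ), ENNReal.ofReal (β * x ^ (-(β + 1))) *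
      {y : ℝ | t < |y|}.indicator 1 x =
      (Set.Ioi t).indicator (fun x => ENNReal.ofReal (β * x ^ (-(β + 1)))) x := fun x hx => by
    have hx0 : 0 < x := one_pos.trans hx
    by_cases h : t < x
    · have h' : x ∈ {y : ℝ | t < |y|} := h.trans_le (le_abs_self x)
      rw [Set.indicator_of_mem h', Set.indicator_of_mem (Set.mem_Ioi.mpr h)]
      simp
    · have h' : x ∉ {y : ℝ | t < |y|} := fun hy => h (by
        rwa [Set.mem_ofPred_eq, abs_of_pos hx0] at hy)
      rw [Set.indicator_of_notMem h', Set.indicator_of_notMem (by simpa using h), mul_zero]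
  rw [← lintegral_indicator_one hm, lintegral_paretoMeasure_one β (measurable_one.indicator hm),
    setLIntegral_congr_fun measurableSet_Ioi hset, lintegral_indicator measurableSet_Ioi,
    Measure.restrict_restrict measurableSet_Ioi, Set.Ioi_inter_Ioi, max_eq_left ht]
  have hi := integrableOn_Ioi_rpow_of_lt (by linarith : -(β + 1) < -1) ht0
  rw [← ofReal_integral_eq_lintegral_ofReal (hi.const_mul β), integral_const_mul,
    integral_Ioi_rpow_of_lt (by linarith) ht0]
  · congr 1
    rw [show -(β + 1) + 1 = -β by ring]
    field_simp
  · filter_upwards [ae_restrict_mem measurableSet_Ioi] with x hx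
    have : 0 < x := ht0.trans hx
    positivity

/-- A mixture of `± a` with a symmetrized Pareto law of exponent `β` and weight `η`. -/
def heavyLaw (a η β : ℝ) : Measure ℝ :=
  ENNReal.ofReal (1 - η) • ((2⁻¹ : ℝ≥0∞) • Measure.dirac a + (2⁻¹ : ℝ≥0∞) • Measure.dirac (-a)) +
    ENNReal.ofReal η • ((2⁻¹ : ℝ≥0∞) • paretoMeasure 1 β +
      (2⁻¹ : ℝ≥0∞) • (paretoMeasure 1 β).map fun y => -y)

lemma isProbabilityMeasure_heavyLaw {a η β : ℝ} (h0 : 0 ≤ η) (h1 : η ≤ 1) (hβ : 0 < β) :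
    IsProbabilityMeasure (heavyLaw a η β) := by
  have := isProbabilityMeasure_paretoMeasure one_pos hβ
  have := Measure.isProbabilityMeasure_map (μ := paretoMeasure 1 β) (f := fun y => -y)
    (by fun_prop)
  refine ⟨?_⟩
  simp only [heavyLaw, Measure.coe_add, Measure.coe_smul, Pi.add_apply, Pi.smul_apply,
    measure_univ, smul_eq_mul, mul_one, ENNReal.inv_two_add_inv_two]
  rw [← ENNReal.ofReal_add (sub_nonneg.mpr h1) h0]
  simp

lemma map_neg_heavyLaw (a η β : ℝ) :
    (heavyLaw a η β).map (fun y => -y) = heavyLaw a η β := by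
  have hm : Measurable fun y : ℝ => -y := measurable_neg
  have hinv : ((paretoMeasure 1 β).map fun y => -y).map (fun y => -y) = paretoMeasure 1 β := by
    rw [Measure.map_map hm hm]
    convert Measure.map_id
    ext y
    simp
  simp only [heavyLaw, Measure.map_add _ _ hm, Measure.map_smul, Measure.map_dirac' hm, hinv,
    neg_neg]
  congr 2 <;> exact add_comm _ _

lemma lintegral_heavyLaw_of_even {a η β : ℝ} {g : ℝ → ℝ≥0∞} (hg : Measurable g)
    (he : ∀ y, g (-y) = g y) :
    ∫⁻ y, g y ∂(heavyLaw a η β) =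
      ENNReal.ofReal (1 - η) * g a + ENNReal.ofReal η * ∫⁻ y, g y ∂(paretoMeasure 1 β) := by
  have hhalf : ∀ z : ℝ≥0∞, 2⁻¹ * z + 2⁻¹ * z = z := fun z => by
    rw [← add_mul, ENNReal.inv_two_add_inv_two, one_mul]
  rw [heavyLaw]
  simp only [lintegral_add_measure, lintegral_smul_measure, lintegral_dirac' _ hg,
    lintegral_map hg measurable_neg, he, smul_eq_mul, hhalf]

lemma absMoment_heavyLaw (a η β s : ℝ) :
    absMoment (heavyLaw a η β) s = ENNReal.ofReal (1 - η) * ‖a‖ₑ ^ s +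
      ENNReal.ofReal η * ∫⁻ y, ‖y‖ₑ ^ s ∂(paretoMeasure 1 β) :=
  lintegral_heavyLaw_of_even (by fun_prop) fun y => by rw [enorm_neg]

lemma absMoment_heavyLaw_lt_top {a η β s : ℝ} (hβ : 0 < β) (hs0 : 0 ≤ s) (hs : s < β) :
    absMoment (heavyLaw a η β) s < ∞ := by
  rw [absMoment_heavyLaw]
  exact ENNReal.add_lt_top.mpr ⟨ENNReal.mul_lt_top ENNReal.ofReal_lt_top
    (ENNReal.rpow_lt_top_of_nonneg hs0 enorm_ne_top),
    ENNReal.mul_lt_top ENNReal.ofReal_lt_top (lintegral_paretoMeasure_rpow_lt_top hβ hs)⟩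

lemma absMoment_heavyLaw_eq_top {a η β s : ℝ} (hη : 0 < η) (hβ : 0 < β) (hs : β ≤ s) :
    absMoment (heavyLaw a η β) s = ∞ := by
  rw [absMoment_heavyLaw, lintegral_paretoMeasure_rpow_eq_top hβ hs,
    ENNReal.mul_top (by simpa using hη), add_top]

lemma heavyLaw_lt_abs_ge {a η β t : ℝ} (h0 : 0 ≤ η) (hβ : 0 < β) (ht : 1 ≤ t) :
    ENNReal.ofReal (η * t ^ (-β)) ≤ heavyLaw a η β {y | t < |y|} := by
  have hm : MeasurableSet {y : ℝ | t < |y|} := measurableSet_lt measurable_const measurable_id.abs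
  rw [← lintegral_indicator_one hm, lintegral_heavyLaw_of_even (measurable_one.indicator hm),
    lintegral_indicator_one hm, paretoMeasure_lt_abs hβ ht, ENNReal.ofReal_mul h0]
  · exact le_add_self
  · intro y
    simp [Set.indicator]

lemma isCentered_heavyLaw {a η β : ℝ} (hβ : 1 < β) :
    IsCentered (heavyLaw a η β) := by
  constructor
  · refine ⟨by fun_prop, ?_⟩
    have h := absMoment_heavyLaw_lt_top (a := a) (η := η) (by linarith : 0 < β) zero_le_one hβ
    simpa [absMoment, HasFiniteIntegral] using h
  · simpa using integral_pow_odd_eq_zero (map_neg_heavyLaw a η β) odd_one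

lemma variance_eq_one_of_absMoment {ρ : Measure ℝ} (hc : IsCentered ρ) (h : absMoment ρ 2 = 1) :
    Var[fun x : ℝ => x; ρ] = 1 := by
  rw [variance, ENNReal.toReal_eq_one_iff, evariance, ← h]
  refine lintegral_congr fun y => ?_
  rw [hc.2, sub_zero]
  norm_num

lemma one_le_lintegral_paretoMeasure_sq {β : ℝ} (hβ : 0 < β) :
    1 ≤ ∫⁻ y, ‖y‖ₑ ^ (2 : ℝ) ∂(paretoMeasure 1 β) := by
  have := isProbabilityMeasure_paretoMeasure one_pos hβ
  have h1 : ∫⁻ _, 1 ∂(paretoMeasure 1 β) = 1 := by simp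
  conv_lhs => rw [← h1]
  rw [lintegral_paretoMeasure_one β measurable_const, lintegral_paretoMeasure_one β (by fun_prop)]
  refine setLIntegral_mono' measurableSet_Ioi fun x hx => ?_
  gcongr
  have hx1 : 1 ≤ x := le_of_lt hx
  rw [← ofReal_norm, Real.norm_of_nonneg (by linarith), ENNReal.ofReal_rpow_of_pos (by linarith)]
  exact ENNReal.one_le_ofReal.mpr (Real.one_le_rpow hx1 (by norm_num))

/-- The parameters of the heavy law can be tuned to make a lower moment small, with unit variance
when this is compatible. -/
lemma exists_heavyLaw_params {β r : ℝ} (hβ : 2 < β) (hr : 0 < r) (hrβ : r < β) {K : ℝ≥0}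
    (hK : 0 < K) :
    ∃ a η : ℝ, 0 < η ∧ η ≤ 1 ∧ absMoment (heavyLaw a η β) r < K ∧
      (1 < K → absMoment (heavyLaw a η β) 2 = 1) := by
  have hβ0 : 0 < β := by linarith
  obtain ⟨m, hm⟩ : ∃ m : ℝ≥0, ∫⁻ y, ‖y‖ₑ ^ r ∂(paretoMeasure 1 β) = m :=
    ⟨_, (ENNReal.coe_toNNReal (lintegral_paretoMeasure_rpow_lt_top hβ0 hrβ).ne).symm⟩
  obtain ⟨v, hv⟩ : ∃ v : ℝ≥0, ∫⁻ y, ‖y‖ₑ ^ (2 : ℝ) ∂(paretoMeasure 1 β) = v :=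
    ⟨_, (ENNReal.coe_toNNReal (lintegral_paretoMeasure_rpow_lt_top hβ0 hβ).ne).symm⟩
  have hv1 : (1 : ℝ) ≤ v := by
    have := one_le_lintegral_paretoMeasure_sq hβ0
    rw [hv] at this
    exact_mod_cast this
  have hm0 : (0 : ℝ) ≤ m := m.2
  have hK0 : (0 : ℝ) < K := hK
  have hmoment : ∀ {a η : ℝ}, 0 ≤ a → 0 ≤ η → η ≤ 1 → ∀ {s : ℝ} {w : ℝ≥0}, 0 < s →
      ∫⁻ y, ‖y‖ₑ ^ s ∂(paretoMeasure 1 β) = w →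
      absMoment (heavyLaw a η β) s = ENNReal.ofReal ((1 - η) * a ^ s + η * w) := by
    intro a η ha h0 h1 s w hs hw
    have h1' : 0 ≤ 1 - η := by linarith
    rw [absMoment_heavyLaw, hw, ← ofReal_norm, Real.norm_of_nonneg ha,
      ENNReal.ofReal_rpow_of_nonneg ha hs.le, ENNReal.ofReal_add (by positivity) (by positivity),
      ENNReal.ofReal_mul h1', ENNReal.ofReal_mul h0, ENNReal.ofReal_coe_nnreal]
  by_cases hK1 : 1 < K
  · have hK1' : (0 : ℝ) < K - 1 := by
      have : (1 : ℝ) < K := by exact_mod_cast hK1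
      linarith
    -- The three bounds keep `1 - η` positive, leave the atoms a nonnegative share `1 - η * v` of
    -- the unit variance, and make the Pareto part of the `r`-th moment less than `K - 1`.
    set η : ℝ := min (1 / 2) (min (1 / (v + 1)) ((K - 1) / (m + 1))) with hη
    have hη0 : 0 < η := by positivity
    have hη1 : η ≤ 1 / 2 := min_le_left _ _
    have hηv : η * v ≤ 1 := by
      have : η ≤ 1 / (v + 1) := (min_le_right _ _).trans (min_le_left _ _)
      rw [le_div_iff₀ (by positivity)] at this
      nlinarith
    have hηm : η * m < K - 1 := by
      have : η ≤ (K - 1) / (m + 1) := (min_le_right _ _).trans (min_le_right _ _)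
      rw [le_div_iff₀ (by positivity)] at this
      nlinarith
    -- This solves `(1 - η) * a ^ 2 + η * v = 1`. As `v ≥ 1`, it gives `a ≤ 1`, so the atoms
    -- contribute at most one to the `r`-th moment.
    set a : ℝ := √((1 - η * v) / (1 - η)) with ha
    have h1η : 0 < 1 - η := by linarith
    have ha2 : a ^ (2 : ℝ) = (1 - η * v) / (1 - η) := by
      rw [Real.rpow_two, ha, Real.sq_sqrt]
      exact div_nonneg (by linarith) h1η.le
    have ha1 : a ≤ 1 := by
      rw [ha, Real.sqrt_le_one, div_le_one h1η]
      nlinarith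
    have ha0 : 0 ≤ a := Real.sqrt_nonneg _
    refine ⟨a, η, hη0, by linarith, ?_, fun _ => ?_⟩
    · rw [hmoment ha0 hη0.le (by linarith) hr hm, ← ENNReal.ofReal_coe_nnreal,
        ENNReal.ofReal_lt_ofReal_iff hK0]
      have : a ^ r ≤ 1 := Real.rpow_le_one ha0 ha1 hr.le
      nlinarith
    · rw [hmoment ha0 hη0.le (by linarith) two_pos hv, ha2, mul_div_cancel₀ _ h1η.ne']
      simp
  · set η : ℝ := min 1 (K / (m + 1)) with hη
    have hη0 : 0 < η := by positivity
    have hηm : η * m < K := by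
      have : η ≤ K / (m + 1) := min_le_right _ _
      rw [le_div_iff₀ (by positivity)] at this
      nlinarith
    -- No variance is prescribed here, so the atoms sit at zero and only the Pareto part counts.
    refine ⟨0, η, hη0, min_le_left _ _, ?_, fun h => absurd h hK1⟩
    rw [hmoment le_rfl hη0.le (min_le_left _ _) hr hm, ← ENNReal.ofReal_coe_nnreal,
      ENNReal.ofReal_lt_ofReal_iff hK0, Real.zero_rpow hr.ne', mul_zero, zero_add]
    exact hηm

/-! ### The lower bound -/

/-- A norm at most `t` forces all `n²` independent entries below `t`, and each exceeds `t` with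
probability at least `p * w`; then `1 - x ≤ exp (-x)`. -/
lemma measure_specNorm_le_le_exp {Ω : Type*} [MeasurableSpace Ω] {P : Measure Ω}
    [IsProbabilityMeasure P] {n : ℕ} {p : ℝ} (h0 : 0 ≤ p) (h1 : p ≤ 1) {ρ : Measure ℝ}
    [IsProbabilityMeasure ρ] {δ ξ : Fin n → Fin n → Ω → ℝ} (h : IsSparseModel P n p ρ δ ξ)
    {t w : ℝ} (hw : ENNReal.ofReal w ≤ ρ {y | t < |y|}) :
    P {ω | specNorm (sparseMatrix δ ξ ω) ≤ t} ≤ ENNReal.ofReal (Real.exp (-(n * n * (p * w)))) := by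
  have := isProbabilityMeasure_entryLaw h0 h1 ρ
  have hm : MeasurableSet {y : ℝ | t < |y|} := measurableSet_lt measurable_const measurable_id.abs
  have hentry : ENNReal.ofReal (p * w) ≤ entryLaw p ρ {y | t < |y|} := by
    rw [← lintegral_indicator_one hm, lintegral_entryLaw h0 h1 ρ (measurable_one.indicator hm),
      lintegral_indicator_one hm, ENNReal.ofReal_mul h0]
    exact le_add_right (by gcongr)
  have hcompl : entryLaw p ρ {y | t < |y|}ᶜ ≤ ENNReal.ofReal (Real.exp (-(p * w))) := by
    rw [prob_compl_eq_one_sub hm]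
    refine (tsub_le_tsub_left hentry 1).trans ?_
    refine tsub_le_iff_right.mpr ?_
    refine le_trans ?_ ENNReal.ofReal_add_le
    refine ENNReal.one_le_ofReal.mpr ?_
    linarith [Real.add_one_le_exp (-(p * w))]
  have hmeas : MeasurableSet {x : Fin n × Fin n → ℝ | specNorm (entryMatrix x) ≤ t} :=
    measurableSet_le measurable_specNorm_entryMatrix measurable_const
  have hmap : P {ω | specNorm (sparseMatrix δ ξ ω) ≤ t} =
      (Measure.pi fun _ : Fin n × Fin n => entryLaw p ρ) {x | specNorm (entryMatrix x) ≤ t} := by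
    rw [← h.map_eq_pi h0 h1, Measure.map_apply _ hmeas]
    · rfl
    · exact measurable_pi_lambda _ fun e => (h.measurable_delta _ _).mul (h.measurable_xi _ _)
  rw [hmap]
  calc _ ≤ (Measure.pi fun _ : Fin n × Fin n => entryLaw p ρ)
        (Set.pi Set.univ fun _ => {y | t < |y|}ᶜ) := by
        refine measure_mono fun x hx e _ => ?_
        have := abs_entry_le_specNorm (entryMatrix x) e.1 e.2
        exact not_lt.mpr (this.trans hx)
    _ = (entryLaw p ρ {y | t < |y|}ᶜ) ^ (n * n) := by
        rw [Measure.pi_pi, Finset.prod_const, Finset.card_univ, Fintype.card_prod, Fintype.card_fin]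
    _ ≤ ENNReal.ofReal (Real.exp (-(p * w))) ^ (n * n) := by gcongr
    _ = _ := by
        rw [← ENNReal.ofReal_pow (Real.exp_pos _).le, ← Real.exp_nat_mul]
        congr 2
        push_cast
        ring

lemma critExp_mul_half {α : ℝ} (h1 : α < 1) : critExp α * ((1 - α) / 2) = 2 - α := by
  have : 1 - α ≠ 0 := by linarith
  unfold critExp
  field_simp

/-- The expected number of entries above `n^ν √(n p)` grows polynomially. -/
lemma eventually_rpow_le_expected_exceedances {α β ν μ γ η : ℝ} {p : ℕ → ℝ} (hβ : 0 < β)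
    (hη : 0 < η) (hγ : γ = 2 - α - β * (ν + (1 - α) / 2)) (hμγ : μ < γ)
    (hp : SameOrder p fun n => (n : ℝ) ^ (-α)) :
    ∀ᶠ n : ℕ in atTop,
      (n : ℝ) ^ μ ≤ n * n * (p n * (η * ((n : ℝ) ^ ν * √(n * p n)) ^ (-β))) := by
  obtain ⟨c, C, hc, hC, hcC⟩ := hp
  have hlim := ((tendsto_rpow_atTop (sub_pos.mpr hμγ)).comp
    (tendsto_natCast_atTop_atTop (R := ℝ))).eventually_ge_atTop ((c * η * √C ^ (-β))⁻¹)
  filter_upwards [hcC, hlim, eventually_ge_atTop 1] with n ⟨hn1, hn2⟩ hn3 hn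
  have hN : (0 : ℝ) < n := by exact_mod_cast hn
  have hpn : 0 < p n := lt_of_lt_of_le (by positivity) hn1
  simp only [Function.comp_apply] at hn3
  have hc' : 0 < c * η * √C ^ (-β) := by positivity
  have hsqrt : (n : ℝ) ^ ν * √(n * p n) ≤ √C * (n : ℝ) ^ (ν + (1 - α) / 2) := by
    have h1 : √(n * p n) ≤ √C * (n : ℝ) ^ ((1 - α) / 2) := by
      rw [show (n : ℝ) ^ ((1 - α) / 2) = √((n : ℝ) ^ (1 - α)) by
        rw [Real.sqrt_eq_rpow, ← Real.rpow_mul hN.le]; congr 1; ring, ← Real.sqrt_mul hC.le]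
      refine Real.sqrt_le_sqrt ?_
      calc n * p n ≤ n * (C * (n : ℝ) ^ (-α)) := by gcongr
        _ = _ := by rw [sub_eq_add_neg, Real.rpow_add hN, Real.rpow_one]; ring
    calc _ ≤ (n : ℝ) ^ ν * (√C * (n : ℝ) ^ ((1 - α) / 2)) := by gcongr
      _ = _ := by rw [Real.rpow_add hN]; ring
  calc (n : ℝ) ^ μ = (n : ℝ) ^ μ * 1 := (mul_one _).symm
    _ ≤ (n : ℝ) ^ μ * (c * η * √C ^ (-β) * (n : ℝ) ^ (γ - μ)) := by
        gcongr
        rwa [inv_le_iff_one_le_mul₀' hc'] at hn3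
    _ = c * η * √C ^ (-β) * (n : ℝ) ^ γ := by
        rw [mul_left_comm, ← Real.rpow_add hN]; congr 2; ring
    _ = n * n * ((c * (n : ℝ) ^ (-α)) * (η * (√C * (n : ℝ) ^ (ν + (1 - α) / 2)) ^ (-β))) := by
        rw [Real.mul_rpow (by positivity) (by positivity), ← Real.rpow_mul hN.le,
          show γ = 1 + 1 + (-α) + (ν + (1 - α) / 2) * (-β) by rw [hγ]; ring, Real.rpow_add hN,
          Real.rpow_add hN, Real.rpow_add hN, Real.rpow_one]
        ring
    _ ≤ _ := by
        have hrpow := Real.rpow_le_rpow_of_nonpos (by positivity) hsqrt (by linarith : -β ≤ 0)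
        gcongr

/-- The moment condition is sharp: below the critical exponent the norm can be larger by a power
of `n` with overwhelming probability. -/
theorem exists_heavyLaw_norm_large {α r : ℝ} (h0 : 0 < α) (h1 : α < 1) (hr : 0 < r)
    (hrq : r < critExp α) :
    ∃ μ ν : ℝ, 0 < μ ∧ 0 < ν ∧ ∀ K : ℝ≥0, 0 < K →
      ∃ ρ : Measure ℝ, IsProbabilityMeasure ρ ∧ IsCentered ρ ∧ absMoment ρ 4 < ⊤ ∧
        (1 < K → Var[fun x : ℝ => x; ρ] = 1) ∧ absMoment ρ r < K ∧
        absMoment ρ (critExp α) = ⊤ ∧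
        ∀ p : ℕ → ℝ, (∀ n, 1 ≤ n → 0 < p n ∧ p n ≤ 1) →
          SameOrder p (fun n => (n : ℝ) ^ (-α)) →
          ∀ᶠ n : ℕ in atTop,
            ∀ (Ω : Type u) [MeasurableSpace Ω] (P : Measure Ω) [IsProbabilityMeasure P]
              (δ ξ : Fin n → Fin n → Ω → ℝ), IsSparseModel P n (p n) ρ δ ξ →
              P {ω | specNorm (sparseMatrix δ ξ ω) ≤ (n : ℝ) ^ ν * √(n * p n)}
                ≤ ENNReal.ofReal (Real.exp (-1 * (n : ℝ) ^ μ)) := by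
  have hq4 := four_lt_critExp h0 h1
  have hqα := critExp_mul_half h1
  set q := critExp α
  -- Strictly between `max r 4` and `q`: the moments of order `r` and `4` are finite while the
  -- `q`-th is infinite.
  set β := (max r 4 + q) / 2 with hβ_def
  have hmax : max r 4 < q := max_lt hrq hq4
  have hrβ : r < β := by have := le_max_left r 4; rw [hβ_def]; linarith
  have h4β : 4 < β := by have := le_max_right r 4; rw [hβ_def]; linarith
  have hβq : β < q := by rw [hβ_def]; linarith
  have hβ0 : 0 < β := by linarith
  set D := (q - β) * (1 - α) with hD_def
  have hD : 0 < D := mul_pos (by linarith) (by linarith)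
  -- Since `q (1 - α) / 2 = 2 - α`, the number of exceedances has exponent `D / 2 - β * ν`, which is
  -- `D / 4` for this `ν`. Taking `μ = D / 8` below it leaves room for all multiplicative constants,
  -- so the absolute constant can be one.
  refine ⟨D / 8, D / (4 * β), by positivity, by positivity, fun K hK => ?_⟩
  obtain ⟨a, η, hη0, hη1, hKr, hvar⟩ := exists_heavyLaw_params (by linarith : 2 < β) hr hrβ hK
  have hprob := isProbabilityMeasure_heavyLaw (a := a) hη0.le hη1 hβ0
  have hcent := isCentered_heavyLaw (a := a) (η := η) (by linarith : 1 < β)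
  refine ⟨heavyLaw a η β, hprob, hcent, absMoment_heavyLaw_lt_top hβ0 (by norm_num) h4β,
    fun hK1 => variance_eq_one_of_absMoment hcent (hvar hK1), hKr,
    absMoment_heavyLaw_eq_top hη0 hβ0 hβq.le, fun p hp hpα => ?_⟩
  have hexc := eventually_rpow_le_expected_exceedances (ν := D / (4 * β)) (μ := D / 8)
    (γ := D / 4) hβ0 hη0 (by
      have hβD : β * (D / (4 * β)) = D / 4 := by field_simp
      rw [mul_add, hβD, hD_def]
      linear_combination hqα) (by linarith) hpα
  -- The Pareto tail is an exact power only above one; the level is eventually there because `n * p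
  -- n` is at least of order `n ^ (1 - α)`.
  have hlarge : ∀ᶠ n : ℕ in atTop, 1 ≤ (n : ℝ) ^ (D / (4 * β)) * √(n * p n) := by
    obtain ⟨c, C, hc, hC, hcC⟩ := hpα
    have hlim := ((tendsto_rpow_atTop (sub_pos.mpr h1)).comp
      (tendsto_natCast_atTop_atTop (R := ℝ))).eventually_ge_atTop c⁻¹
    filter_upwards [hcC, hlim, eventually_ge_atTop 1] with n ⟨hn1, _⟩ hn3 hn
    have hN : (0 : ℝ) < n := by exact_mod_cast hn
    have hN1 : (1 : ℝ) ≤ n := by exact_mod_cast hn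
    have hnp : 1 ≤ n * p n := by
      simp only [Function.comp_apply] at hn3
      rw [inv_le_iff_one_le_mul₀' hc] at hn3
      calc 1 ≤ c * (n : ℝ) ^ (1 - α) := hn3
        _ = n * (c * (n : ℝ) ^ (-α)) := by
            rw [sub_eq_add_neg, Real.rpow_add hN, Real.rpow_one]; ring
        _ ≤ _ := by gcongr
    exact one_le_mul_of_one_le_of_one_le (Real.one_le_rpow hN1 (by positivity))
      (Real.one_le_sqrt.mpr hnp)
  filter_upwards [hexc, hlarge, eventually_ge_atTop 1] with n hn1 hn2 hn Ω _ P _ δ ξ hm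
  refine (measure_specNorm_le_le_exp (hp n hn).1.le (hp n hn).2 hm
    (heavyLaw_lt_abs_ge hη0.le hβ0 hn2)).trans (ENNReal.ofReal_le_ofReal ?_)
  rw [Real.exp_le_exp, neg_one_mul, neg_le_neg_iff]
  exact hn1

end SparseNorm

end

theorem theorem1p4 :
    -- Part (i)
    (∀ α : ℝ, 0 < α → α < 1 →
      ∀ r : ℝ, 0 < r → r < SparseNorm.critExp α → ∀ K M : ℝ≥0,
        -- a constant that depends on the sequence only through its `Ω`-constant, for large `n`
        (∀ κ : ℝ, 0 < κ → ∃ C : ℝ, 0 < C ∧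
          ∀ p : ℕ → ℝ, (∀ n, 1 ≤ n → 0 < p n ∧ p n ≤ 1) →
            SparseNorm.OmegaWith κ p (fun n => (n : ℝ) ^ (-α)) →
            ∀ᶠ n in atTop,
              SparseNorm.NormMomentBound.{u} (SparseNorm.critExp α) K M r C n (p n)) ∧
        -- for a given sequence, a constant that serves all `n ≥ 1`
        (∀ p : ℕ → ℝ, (∀ n, 1 ≤ n → 0 < p n ∧ p n ≤ 1) →
          SparseNorm.IsOmega p (fun n => (n : ℝ) ^ (-α)) →
          ∃ C : ℝ, 0 < C ∧ ∀ n, 1 ≤ n →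
            SparseNorm.NormMomentBound.{u} (SparseNorm.critExp α) K M r C n (p n))) ∧
    -- Part (ii)
    (∃ C : ℝ, 0 < C ∧
      ∀ α : ℝ, 0 < α → α < 1 → ∀ r : ℝ, 0 < r → r < SparseNorm.critExp α →
        ∃ μ ν : ℝ, 0 < μ ∧ 0 < ν ∧ ∀ K : ℝ≥0, 0 < K →
          ∃ ρ : Measure ℝ, IsProbabilityMeasure ρ ∧ SparseNorm.IsCentered ρ ∧
            SparseNorm.absMoment ρ 4 < ⊤ ∧
            (1 < K → Var[fun x : ℝ => x; ρ] = 1) ∧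
            SparseNorm.absMoment ρ r < K ∧
            SparseNorm.absMoment ρ (SparseNorm.critExp α) = ⊤ ∧
            ∀ p : ℕ → ℝ, (∀ n, 1 ≤ n → 0 < p n ∧ p n ≤ 1) →
              SparseNorm.SameOrder p (fun n => (n : ℝ) ^ (-α)) →
              ∀ᶠ n : ℕ in atTop,
                ∀ (Ω : Type u) [MeasurableSpace Ω] (P : Measure Ω) [IsProbabilityMeasure P]
                  (δ ξ : Fin n → Fin n → Ω → ℝ), SparseNorm.IsSparseModel P n (p n) ρ δ ξ →
                  P {ω | SparseNorm.specNorm (SparseNorm.sparseMatrix δ ξ ω)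
                        ≤ (n : ℝ) ^ ν * √(n * p n)}
                    ≤ ENNReal.ofReal (Real.exp (-C * (n : ℝ) ^ μ))) := by
  refine ⟨fun α h0 h1 r hr hrq K M => ⟨fun κ hκ => ?_, fun p hp hΩ => ?_⟩,
    1, one_pos, fun α h0 h1 r hr hrq => ?_⟩
  · exact SparseNorm.normMomentBound_of_omegaWith h0 h1 hr hrq K M hκ
  · exact SparseNorm.normMomentBound_of_isOmega h0 h1 hr hrq K M hp hΩ
  · exact SparseNorm.exists_heavyLaw_norm_large h0 h1 hr hrq
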